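/- Let $\Bbbk$ be an algebraically closed field of characteristic zero and let $N\ge 1$. Let $V$ be a superspace over $\Bbbk$ with an ordered homogeneous basis $v_1,\dots,v_{N+1}$, and let $\bar k\in\mathbb Z/2$ be the parity of $v_k$. Put $I=\{1,\dots,N\}$. On $\bigoplus_{k=1}^{N+1}\mathbb Z\epsilon_k$ take the bilinear form $(\epsilon_k,\epsilon_l)=\delta_{kl}(-1)^{\bar k}$. For $i,j\in I$ let $\alpha_i=\epsilon_i-\epsilon_{i+1}$, $c_{ij}=(\alpha_i,\alpha_j)$ and $|\alpha_i|=\bar i+\overline{i+1}\in\mathbb Z/2$. The vertex $i$ is even or odd according to $|\alpha_i|$, and the neighbours of $i$ are the $j\in I$ with $j=i\pm1$. For homogeneous elements of a superalgebra write $[x,y]=xy-(-1)^{|x||y|}yx$ and $\{x,y\}=xy+(-1)^{|x||y|}yx$. The Drinfeld super Yangian $Y_\hbar(\mathfrak{sl}(V))$ is the unital associative $\Bbbk[[\hbar]]$-superalgebra generated by $h_{ir},x^{\pm}_{ir}$ ($i\in I$, $r\in\mathbb Z_{\ge0}$), with parities $|h_{ir}|=\bar0$ and $|x^\pm_{ir}|=|\alpha_i|$,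 subject to the following relations for all $i,j\in I$ and $r,s,t\ge 0$: \begin{itemize} \item $[h_{ir},h_{js}]=0$; \item $[h_{i0},x^\pm_{js}]=\pm c_{ij}x^\pm_{js}$; \item $[x^+_{ir},x^-_{js}]=\delta_{ij}h_{i,r+s}$; \item $[h_{i,r+1},x^\pm_{js}]-[h_{ir},x^\pm_{j,s+1}]=\pm\frac{c_{ij}\hbar}{2}\{h_{ir},x^\pm_{js}\}$ unless $i=j$ and $|\alpha_i|=\bar1$; \item $[x^\pm_{i,r+1},x^\pm_{js}]-[x^\pm_{ir},x^\pm_{j,s+1}]=\pm\frac{c_{ij}\hbar}{2}\{x^\pm_{ir},x^\pm_{js}\}$ unless $i=j$ and $|\alpha_i|=\bar1$; \item $[h_{ir},x^\pm_{is}]=0$ if $|\alpha_i|=\bar1$; \item $[x^\pm_{ir},x^\pm_{js}]=0$ if $c_{ij}=0$; \item $[x^\pm_{ir},[x^\pm_{is},x^\pm_{jt}]]+[x^\pm_{is},[x^\pm_{ir},x^\pm_{jt}]]=0$ if $|i-j|=1$ and $|\alpha_i|=\bar0$; \item $[[x^\pm_{j-1,r},x^\pm_{j0}],[x^\pm_{j0},x^\pm_{j+1,s}]]=0$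 if $j-1,j,j+1\in I$ and $|\alpha_j|=\bar1$. \end{itemize} Assume that $N\ne1$, that it is not the case that $N=3$ and $|\alpha_1|=|\alpha_3|$, and that every odd vertex has at least one even neighbour. Then $Y_\hbar(\mathfrak{sl}(V))$ is isomorphic, as a $\Bbbk[[\hbar]]$-superalgebra, to the superalgebra generated by $h_{ir},x^\pm_{ir}$ ($i\in I$, $r\in\{0,1\}$), with parities $|h_{ir}|=\bar0$ and $|x^\pm_{ir}|=|\alpha_i|$, subject only to the following relations for all $i,j\in I$, where $\widetilde h_{i1}=h_{i1}-\frac{\hbar}{2}h_{i0}^2$: \begin{enumerate} \item $[h_{ir},h_{js}]=0$ for $0\le r,s\le1$; \item $[h_{i0},x^\pm_{js}]=\pm c_{ij}x^\pm_{js}$ for $s=0,1$; \item $[x^+_{ir},x^-_{js}]=\delta_{ij}h_{i,r+s}$ for $0\le r+s\le1$; \item $[\widetilde h_{i1},x^\pm_{j0}]=\pm c_{ij}x^\pm_{j1}$ unless $i=j$ and $|\alpha_i|=\bar1$; \item $[x^\pm_{i1},x^\pm_{j0}]-[x^\pm_{i0},x^\pm_{j1}]=\pm\frac{c_{ij}\hbar}{2}\{x^\pm_{i0},x^\pm_{j0}\}$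 unless $i=j$ and $|\alpha_i|=\bar1$; \item $[h_{i1},x^\pm_{is}]=0$ for $s=0,1$ if $|\alpha_i|=\bar1$; \item $[x^\pm_{i0},x^\pm_{j0}]=0$ if $c_{ij}=0$; \item $[x^\pm_{i0},[x^\pm_{i0},x^\pm_{j0}]]=0$ if $|i-j|=1$ and $|\alpha_i|=\bar0$; \item $[[x^\pm_{j-1,0},x^\pm_{j0}],[x^\pm_{j0},x^\pm_{j+1,0}]]=0$ if $j-1,j,j+1\in I$ and $|\alpha_j|=\bar1$. \end{enumerate} The isomorphism may be chosen to preserve parity and to send each generator $h_{ir}$, $x^\pm_{ir}$ with $r\in\{0,1\}$ to the generator of $Y_\hbar(\mathfrak{sl}(V))$ of the same name. -/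

import Mathlib

noncomputable section

/-! ### Superalgebras given by generators and homogeneous relations -/

namespace SuperPresentation

/-- The sign `(-1)^a` for `a ∈ ℤ/2`. -/
def sgn (a : ZMod 2) : ℤ := if a = 0 then 1 else -1

section

variable (R : Type*) [CommRing R] {G : Type*} (par : G → ZMod 2)

/-- The parity-`a` part of the free superalgebra on generators `g` of parity `par g`:
the span of the words whose letters have total parity `a`. -/
def freeGrading (a : ZMod 2) : Submodule R (FreeAlgebra R G) :=
  Submodule.span R
    {w | ∃ l : List G, (l.map par).sum = a ∧ (l.map (FreeAlgebra.ι R)).prod = w}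

instance freeGrading_gradedMonoid : SetLike.GradedMonoid (freeGrading R par) where
  one_mem := Submodule.subset_span ⟨[], by simp⟩
  mul_mem := by
    intro a b x y hx hy
    have h := Submodule.mul_mem_mul hx hy
    rw [freeGrading, freeGrading, Submodule.span_mul_span] at h
    refine Submodule.span_mono ?_ h
    rintro _ ⟨_, ⟨l, hl, rfl⟩, _, ⟨l', hl', rfl⟩, rfl⟩
    exact ⟨l ++ l', by simp [hl, hl']⟩

lemma ι_mem_freeGrading (g : G) : FreeAlgebra.ι R g ∈ freeGrading R par (par g) :=
  Submodule.subset_span ⟨[g], by simp⟩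

/-- A homogeneous element of the free superalgebra, together with its parity. -/
structure Homog where
  /-- the parity `|x|` -/
  deg : ZMod 2
  /-- the underlying element `x` -/
  val : FreeAlgebra R G
  mem : val ∈ freeGrading R par deg

namespace Homog

variable {R par}

/-- The super commutator `[x, y] = x y - (-1)^{|x||y|} y x`, of parity `|x| + |y|`. -/
def comm (x y : Homog R par) : Homog R par where
  deg := x.deg + y.deg
  val := x.val * y.val - sgn (x.deg * y.deg) • (y.val * x.val)
  mem := by
    refine sub_mem (SetLike.mul_mem_graded x.mem y.mem) (zsmul_mem ?_ _)
    rw [add_comm]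
    exact SetLike.mul_mem_graded y.mem x.mem

/-- The super anticommutator `{x, y} = x y + (-1)^{|x||y|} y x`, of parity `|x| + |y|`. -/
def anti (x y : Homog R par) : Homog R par where
  deg := x.deg + y.deg
  val := x.val * y.val + sgn (x.deg * y.deg) • (y.val * x.val)
  mem := by
    refine add_mem (SetLike.mul_mem_graded x.mem y.mem) (zsmul_mem ?_ _)
    rw [add_comm]
    exact SetLike.mul_mem_graded y.mem x.mem

end Homog

variable (rel : FreeAlgebra R G → FreeAlgebra R G → Prop)

/-- The parity-`a` part of the superalgebra with generators `G` and relations `rel`. -/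
def grading (a : ZMod 2) : Submodule R (RingQuot rel) :=
  (freeGrading R par a).map (RingQuot.mkAlgHom R rel).toLinearMap

instance grading_gradedMonoid : SetLike.GradedMonoid (grading R par rel) where
  one_mem := ⟨1, SetLike.one_mem_graded (freeGrading R par), map_one (RingQuot.mkAlgHom R rel)⟩
  mul_mem := by
    rintro a b _ _ ⟨x, hx, rfl⟩ ⟨y, hy, rfl⟩
    exact ⟨x * y, SetLike.mul_mem_graded hx hy, map_mul (RingQuot.mkAlgHom R rel) x y⟩

/-- The algebra map splitting an element of the free algebra into its parity components in
the quotient. -/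
def splitFree : FreeAlgebra R G →ₐ[R] DirectSum (ZMod 2) fun a => grading R par rel a :=
  FreeAlgebra.lift R fun g =>
    DirectSum.of (fun a => grading R par rel a) (par g)
      ⟨RingQuot.mkAlgHom R rel (FreeAlgebra.ι R g), _, ι_mem_freeGrading R par g, rfl⟩

lemma coe_splitFree (x : FreeAlgebra R G) :
    DirectSum.coeAlgHom (grading R par rel) (splitFree R par rel x) =
      RingQuot.mkAlgHom R rel x := by
  have : (DirectSum.coeAlgHom (grading R par rel)).comp (splitFree R par rel) =
      RingQuot.mkAlgHom R rel := by
    ext g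
    simp [splitFree]
  exact DFunLike.congr_fun this x

lemma splitFree_mem {a : ZMod 2} {x : FreeAlgebra R G} (hx : x ∈ freeGrading R par a) :
    splitFree R par rel x =
      DirectSum.lof R (ZMod 2) (fun a => grading R par rel a) a
        ⟨RingQuot.mkAlgHom R rel x, x, hx, rfl⟩ := by
  have key : splitFree R par rel x ∈
      LinearMap.range (DirectSum.lof R (ZMod 2) (fun a => grading R par rel a) a) := by
    have hle : freeGrading R par a ≤ (LinearMap.range
        (DirectSum.lof R (ZMod 2) (fun a => grading R par rel a) a)).comap
        (splitFree R par rel).toLinearMap := by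
      refine Submodule.span_le.2 ?_
      rintro _ ⟨l, rfl, rfl⟩
      clear hx
      induction l with
      | nil =>
        exact ⟨GradedMonoid.GOne.one (A := fun a => grading R par rel a),
          (map_one (splitFree R par rel)).symm⟩
      | cons g l ih =>
        obtain ⟨y, hy⟩ := ih
        refine ⟨GradedMonoid.GMul.mul (A := fun a => grading R par rel a)
          ⟨RingQuot.mkAlgHom R rel (FreeAlgebra.ι R g), _, ι_mem_freeGrading R par g, rfl⟩ y, ?_⟩
        simp only [AlgHom.toLinearMap_apply, List.map_cons, List.prod_cons, map_mul] at hy ⊢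
        rw [← hy, splitFree, FreeAlgebra.lift_ι_apply]
        exact (DirectSum.of_mul_of _ _).symm
    exact hle hx
  obtain ⟨y, hy⟩ := key
  rw [← hy]
  congr 1
  ext
  have h := coe_splitFree R par rel x
  rw [← hy, DirectSum.lof_eq_of, DirectSum.coeAlgHom_of] at h
  exact h

/-- If every relation equates two elements of the same parity, the quotient is a superalgebra,
that is, a `ℤ/2`-graded algebra. -/
@[reducible] def gradedAlgebra
    (hrel : ∀ x y, rel x y → ∃ a, x ∈ freeGrading R par a ∧ y ∈ freeGrading R par a) :
    GradedAlgebra (grading R par rel) := by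
  refine GradedAlgebra.ofAlgHom (grading R par rel)
    (RingQuot.liftAlgHom R ⟨splitFree R par rel, ?_⟩) ?_ ?_
  · intro x y h
    obtain ⟨a, hx, hy⟩ := hrel x y h
    rw [splitFree_mem R par rel hx, splitFree_mem R par rel hy]
    congr 2
    exact RingQuot.mkAlgHom_rel R h
  · apply RingQuot.ringQuot_ext'
    ext g
    simp [splitFree]
  · rintro a ⟨_, x, hx, rfl⟩
    have h := splitFree_mem R par rel hx
    rw [DirectSum.lof_eq_of] at h
    simpa using h

end

end SuperPresentation

/-! ### The root datum of `sl(V)` and the Drinfeld super Yangian -/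

namespace SuperYangian

open SuperPresentation

section RootDatum

variable {N : ℕ} (p : Fin (N + 1) → ZMod 2)

/-- The form on `P = ⨁ ℤ ε_k` with `(ε_k, ε_l) = δ_{kl} (-1)^{p k}`, where `p k` is the parity
of the `k`-th basis vector of `V`. -/
def form (u v : Fin (N + 1) → ℤ) : ℤ := ∑ k, sgn (p k) * (u k * v k)

/-- The simple root `α_i = ε_i - ε_{i+1}`. -/
def simpleRoot (i : Fin N) : Fin (N + 1) → ℤ :=
  Pi.single i.castSucc 1 - Pi.single i.succ 1

/-- The Cartan matrix `c_{ij} = (α_i, α_j)`. -/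
def cartan (i j : Fin N) : ℤ := form p (simpleRoot i) (simpleRoot j)

/-- The parity `|α_i|`, the sum of the parities of the `i`-th and `(i+1)`-st basis vectors. -/
def rootParity (i : Fin N) : ZMod 2 := p i.castSucc + p i.succ

/-- Neighbouring vertices of the Dynkin diagram: `j = i ± 1`. -/
def Neighbour (i j : Fin N) : Prop := (i : ℕ) + 1 = j ∨ (j : ℕ) + 1 = i

end RootDatum

/-- Generators `h_{i,r}` and `x^±_{i,r}` with `i ∈ I = Fin N` and level `r ∈ L`.
The sign `±` is an element of `ℤˣ = {1, -1}`. -/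
inductive Gen (N : ℕ) (L : Type) : Type
  | h (i : Fin N) (r : L) : Gen N L
  | x (ε : ℤˣ) (i : Fin N) (r : L) : Gen N L

section

variable (𝕜 : Type*) [Field 𝕜] {N : ℕ} (p : Fin (N + 1) → ZMod 2)

/-- The parities `|h_{i,r}| = 0`, `|x^±_{i,r}| = |α_i|`. -/
def Gen.parity {L : Type} : Gen N L → ZMod 2
  | .h _ _ => 0
  | .x _ i _ => rootParity p i

/-- The scalar `ħ / 2` of `𝕜[[ħ]]`. -/
def halfHbar : PowerSeries 𝕜 := PowerSeries.C (1 / 2 : 𝕜) * PowerSeries.X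

/-- Homogeneous elements of the free `𝕜[[ħ]]`-superalgebra on the generators of levels `L`. -/
abbrev Elt (L : Type) : Type _ := Homog (PowerSeries 𝕜) (Gen.parity (L := L) p)

/-- A generator as a homogeneous element of the free superalgebra. -/
def gen {L : Type} (g : Gen N L) : Elt 𝕜 p L :=
  ⟨g.parity p, FreeAlgebra.ι _ g, ι_mem_freeGrading _ _ g⟩

/-- `h_{i,r}` in the free superalgebra. -/
abbrev fh {L : Type} (i : Fin N) (r : L) : Elt 𝕜 p L := gen 𝕜 p (.h i r)

/-- `x^±_{i,r}` in the free superalgebra. -/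
abbrev fx {L : Type} (ε : ℤˣ) (i : Fin N) (r : L) : Elt 𝕜 p L := gen 𝕜 p (.x ε i r)

/-- The defining relations of the Drinfeld super Yangian. -/
inductive YangianRel : FreeAlgebra (PowerSeries 𝕜) (Gen N ℕ) →
    FreeAlgebra (PowerSeries 𝕜) (Gen N ℕ) → Prop
  | hh (i j : Fin N) (r s : ℕ) :
      YangianRel ((fh 𝕜 p i r).comm (fh 𝕜 p j s)).val 0
  | h0x (ε : ℤˣ) (i j : Fin N) (s : ℕ) :
      YangianRel ((fh 𝕜 p i 0).comm (fx 𝕜 p ε j s)).val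
        (((ε : ℤ) * cartan p i j) • (fx 𝕜 p ε j s).val)
  | xx_same (i : Fin N) (r s : ℕ) :
      YangianRel ((fx 𝕜 p 1 i r).comm (fx 𝕜 p (-1) i s)).val (fh 𝕜 p i (r + s)).val
  | xx_ne (i j : Fin N) (r s : ℕ) (hij : i ≠ j) :
      YangianRel ((fx 𝕜 p 1 i r).comm (fx 𝕜 p (-1) j s)).val 0
  | hx (ε : ℤˣ) (i j : Fin N) (r s : ℕ) (hij : ¬ (i = j ∧ rootParity p i = 1)) :
      YangianRel
        (((fh 𝕜 p i (r + 1)).comm (fx 𝕜 p ε j s)).val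
          - ((fh 𝕜 p i r).comm (fx 𝕜 p ε j (s + 1))).val)
        (((ε : ℤ) * cartan p i j) • halfHbar 𝕜 • ((fh 𝕜 p i r).anti (fx 𝕜 p ε j s)).val)
  | xx (ε : ℤˣ) (i j : Fin N) (r s : ℕ) (hij : ¬ (i = j ∧ rootParity p i = 1)) :
      YangianRel
        (((fx 𝕜 p ε i (r + 1)).comm (fx 𝕜 p ε j s)).val
          - ((fx 𝕜 p ε i r).comm (fx 𝕜 p ε j (s + 1))).val)
        (((ε : ℤ) * cartan p i j) • halfHbar 𝕜 • ((fx 𝕜 p ε i r).anti (fx 𝕜 p ε j s)).val)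
  | hx_odd (ε : ℤˣ) (i : Fin N) (r s : ℕ) (hi : rootParity p i = 1) :
      YangianRel ((fh 𝕜 p i r).comm (fx 𝕜 p ε i s)).val 0
  | xx_zero (ε : ℤˣ) (i j : Fin N) (r s : ℕ) (hij : cartan p i j = 0) :
      YangianRel ((fx 𝕜 p ε i r).comm (fx 𝕜 p ε j s)).val 0
  | cubic (ε : ℤˣ) (i j : Fin N) (r s t : ℕ) (hij : Neighbour i j)
      (hi : rootParity p i = 0) :
      YangianRel
        (((fx 𝕜 p ε i r).comm ((fx 𝕜 p ε i s).comm (fx 𝕜 p ε j t))).val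
          + ((fx 𝕜 p ε i s).comm ((fx 𝕜 p ε i r).comm (fx 𝕜 p ε j t))).val) 0
  | quartic (ε : ℤˣ) (i j k : Fin N) (r s : ℕ) (hij : (i : ℕ) + 1 = j)
      (hjk : (j : ℕ) + 1 = k) (hj : rootParity p j = 1) :
      YangianRel
        (((fx 𝕜 p ε i r).comm (fx 𝕜 p ε j 0)).comm
          ((fx 𝕜 p ε j 0).comm (fx 𝕜 p ε k s))).val 0

/-- The element `h_{i1} - (ħ/2) h_{i0}^2` of the free superalgebra, of parity `0`. -/
def hTilde (i : Fin N) : Elt 𝕜 p (Fin 2) where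
  deg := 0
  val := (fh 𝕜 p i (1 : Fin 2)).val - halfHbar 𝕜 • (fh 𝕜 p i (0 : Fin 2)).val ^ 2
  mem := by
    refine sub_mem (fh 𝕜 p i (1 : Fin 2)).mem (Submodule.smul_mem _ _ ?_)
    have h := SetLike.pow_mem_graded 2 (fh 𝕜 p i (0 : Fin 2)).mem
    simpa [gen, Gen.parity] using h

/-- The finite list of relations of the minimalistic presentation; the levels lie in
`Fin 2 = {0, 1}`. -/
inductive MinimalRel : FreeAlgebra (PowerSeries 𝕜) (Gen N (Fin 2)) →
    FreeAlgebra (PowerSeries 𝕜) (Gen N (Fin 2)) → Prop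
  | hh (i j : Fin N) (r s : Fin 2) :
      MinimalRel ((fh 𝕜 p i r).comm (fh 𝕜 p j s)).val 0
  | h0x (ε : ℤˣ) (i j : Fin N) (s : Fin 2) :
      MinimalRel ((fh 𝕜 p i (0 : Fin 2)).comm (fx 𝕜 p ε j s)).val
        (((ε : ℤ) * cartan p i j) • (fx 𝕜 p ε j s).val)
  | xx_same (i : Fin N) (r s t : Fin 2) (hrs : (r : ℕ) + s = t) :
      MinimalRel ((fx 𝕜 p 1 i r).comm (fx 𝕜 p (-1) i s)).val (fh 𝕜 p i t).val
  | xx_ne (i j : Fin N) (r s : Fin 2) (hrs : (r : ℕ) + s ≤ 1) (hij : i ≠ j) :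
      MinimalRel ((fx 𝕜 p 1 i r).comm (fx 𝕜 p (-1) j s)).val 0
  | hx (ε : ℤˣ) (i j : Fin N) (hij : ¬ (i = j ∧ rootParity p i = 1)) :
      MinimalRel ((hTilde 𝕜 p i).comm (fx 𝕜 p ε j (0 : Fin 2))).val
        (((ε : ℤ) * cartan p i j) • (fx 𝕜 p ε j (1 : Fin 2)).val)
  | xx (ε : ℤˣ) (i j : Fin N) (hij : ¬ (i = j ∧ rootParity p i = 1)) :
      MinimalRel
        (((fx 𝕜 p ε i (1 : Fin 2)).comm (fx 𝕜 p ε j (0 : Fin 2))).val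
          - ((fx 𝕜 p ε i (0 : Fin 2)).comm (fx 𝕜 p ε j (1 : Fin 2))).val)
        (((ε : ℤ) * cartan p i j) • halfHbar 𝕜 •
          ((fx 𝕜 p ε i (0 : Fin 2)).anti (fx 𝕜 p ε j (0 : Fin 2))).val)
  | hx_odd (ε : ℤˣ) (i : Fin N) (s : Fin 2) (hi : rootParity p i = 1) :
      MinimalRel ((fh 𝕜 p i (1 : Fin 2)).comm (fx 𝕜 p ε i s)).val 0
  | xx_zero (ε : ℤˣ) (i j : Fin N) (hij : cartan p i j = 0) :
      MinimalRel ((fx 𝕜 p ε i (0 : Fin 2)).comm (fx 𝕜 p ε j (0 : Fin 2))).val 0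
  | cubic (ε : ℤˣ) (i j : Fin N) (hij : Neighbour i j) (hi : rootParity p i = 0) :
      MinimalRel
        ((fx 𝕜 p ε i (0 : Fin 2)).comm
          ((fx 𝕜 p ε i (0 : Fin 2)).comm (fx 𝕜 p ε j (0 : Fin 2)))).val 0
  | quartic (ε : ℤˣ) (i j k : Fin N) (hij : (i : ℕ) + 1 = j) (hjk : (j : ℕ) + 1 = k)
      (hj : rootParity p j = 1) :
      MinimalRel
        (((fx 𝕜 p ε i (0 : Fin 2)).comm (fx 𝕜 p ε j (0 : Fin 2))).comm
          ((fx 𝕜 p ε j (0 : Fin 2)).comm (fx 𝕜 p ε k (0 : Fin 2)))).val 0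

/-- The Drinfeld super Yangian `Y_ħ(sl(V))` over `𝕜[[ħ]]`. -/
abbrev Yangian : Type _ := RingQuot (YangianRel 𝕜 p)

/-- The superalgebra of the minimalistic presentation. -/
abbrev MinimalYangian : Type _ := RingQuot (MinimalRel 𝕜 p)

/-- The `ℤ/2`-grading of the Drinfeld super Yangian. -/
abbrev Yangian.parityPart (a : ZMod 2) : Submodule (PowerSeries 𝕜) (Yangian 𝕜 p) :=
  grading (PowerSeries 𝕜) (Gen.parity p) (YangianRel 𝕜 p) a

/-- The `ℤ/2`-grading of the superalgebra of the minimalistic presentation. -/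
abbrev MinimalYangian.parityPart (a : ZMod 2) :
    Submodule (PowerSeries 𝕜) (MinimalYangian 𝕜 p) :=
  grading (PowerSeries 𝕜) (Gen.parity p) (MinimalRel 𝕜 p) a

lemma yangianRel_homogeneous (a b : FreeAlgebra (PowerSeries 𝕜) (Gen N ℕ))
    (h : YangianRel 𝕜 p a b) : ∃ d, a ∈ freeGrading (PowerSeries 𝕜) (Gen.parity p) d ∧
      b ∈ freeGrading (PowerSeries 𝕜) (Gen.parity p) d := by
  cases h with
  | hh => exact ⟨_, Homog.mem _, zero_mem _⟩
  | h0x ε i j s =>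
    refine ⟨_, Homog.mem _, zsmul_mem ?_ _⟩
    simpa [Homog.comm, gen, Gen.parity] using (fx 𝕜 p ε j s).mem
  | xx_same i r s =>
    refine ⟨_, Homog.mem _, ?_⟩
    simpa [Homog.comm, gen, Gen.parity, CharTwo.add_self_eq_zero] using (fh 𝕜 p i (r + s)).mem
  | xx_ne => exact ⟨_, Homog.mem _, zero_mem _⟩
  | hx ε i j r s =>
    exact ⟨_, sub_mem (Homog.mem _) ((fh 𝕜 p i r).comm (fx 𝕜 p ε j (s + 1))).mem,
      zsmul_mem (Submodule.smul_mem _ _ ((fh 𝕜 p i r).anti (fx 𝕜 p ε j s)).mem) _⟩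
  | xx ε i j r s =>
    exact ⟨_, sub_mem (Homog.mem _) ((fx 𝕜 p ε i r).comm (fx 𝕜 p ε j (s + 1))).mem,
      zsmul_mem (Submodule.smul_mem _ _ ((fx 𝕜 p ε i r).anti (fx 𝕜 p ε j s)).mem) _⟩
  | hx_odd => exact ⟨_, Homog.mem _, zero_mem _⟩
  | xx_zero => exact ⟨_, Homog.mem _, zero_mem _⟩
  | cubic ε i j r s t =>
    exact ⟨_, add_mem (Homog.mem _)
      ((fx 𝕜 p ε i s).comm ((fx 𝕜 p ε i r).comm (fx 𝕜 p ε j t))).mem, zero_mem _⟩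
  | quartic => exact ⟨_, Homog.mem _, zero_mem _⟩

lemma minimalRel_homogeneous (a b : FreeAlgebra (PowerSeries 𝕜) (Gen N (Fin 2)))
    (h : MinimalRel 𝕜 p a b) : ∃ d, a ∈ freeGrading (PowerSeries 𝕜) (Gen.parity p) d ∧
      b ∈ freeGrading (PowerSeries 𝕜) (Gen.parity p) d := by
  cases h with
  | hh => exact ⟨_, Homog.mem _, zero_mem _⟩
  | h0x ε i j s =>
    refine ⟨_, Homog.mem _, zsmul_mem ?_ _⟩
    simpa [Homog.comm, gen, Gen.parity] using (fx 𝕜 p ε j s).mem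
  | xx_same i r s t =>
    refine ⟨_, Homog.mem _, ?_⟩
    simpa [Homog.comm, gen, Gen.parity, CharTwo.add_self_eq_zero] using (fh 𝕜 p i t).mem
  | xx_ne => exact ⟨_, Homog.mem _, zero_mem _⟩
  | hx ε i j =>
    refine ⟨_, Homog.mem _, zsmul_mem ?_ _⟩
    simpa [Homog.comm, hTilde, gen, Gen.parity] using (fx 𝕜 p ε j (1 : Fin 2)).mem
  | xx ε i j =>
    exact ⟨_, sub_mem (Homog.mem _)
        ((fx 𝕜 p ε i (0 : Fin 2)).comm (fx 𝕜 p ε j (1 : Fin 2))).mem,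
      zsmul_mem (Submodule.smul_mem _ _
        ((fx 𝕜 p ε i (0 : Fin 2)).anti (fx 𝕜 p ε j (0 : Fin 2))).mem) _⟩
  | hx_odd => exact ⟨_, Homog.mem _, zero_mem _⟩
  | xx_zero => exact ⟨_, Homog.mem _, zero_mem _⟩
  | cubic => exact ⟨_, Homog.mem _, zero_mem _⟩
  | quartic => exact ⟨_, Homog.mem _, zero_mem _⟩

/-- The Drinfeld super Yangian is a superalgebra. -/
instance : GradedAlgebra (Yangian.parityPart 𝕜 p) :=
  gradedAlgebra _ _ _ (yangianRel_homogeneous 𝕜 p)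

/-- The minimalistic presentation defines a superalgebra. -/
instance : GradedAlgebra (MinimalYangian.parityPart 𝕜 p) :=
  gradedAlgebra _ _ _ (minimalRel_homogeneous 𝕜 p)

/-- The generator `h_{i,r}` of the Drinfeld super Yangian. -/
def Yangian.h (i : Fin N) (r : ℕ) : Yangian 𝕜 p :=
  RingQuot.mkAlgHom (PowerSeries 𝕜) (YangianRel 𝕜 p) (fh 𝕜 p i r).val

/-- The generator `x^±_{i,r}` of the Drinfeld super Yangian. -/
def Yangian.x (ε : ℤˣ) (i : Fin N) (r : ℕ) : Yangian 𝕜 p :=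
  RingQuot.mkAlgHom (PowerSeries 𝕜) (YangianRel 𝕜 p) (fx 𝕜 p ε i r).val

/-- The generator `h_{i,r}`, `r ∈ {0, 1}`, of the minimalistic presentation. -/
def MinimalYangian.h (i : Fin N) (r : Fin 2) : MinimalYangian 𝕜 p :=
  RingQuot.mkAlgHom (PowerSeries 𝕜) (MinimalRel 𝕜 p) (fh 𝕜 p i r).val

/-- The generator `x^±_{i,r}`, `r ∈ {0, 1}`, of the minimalistic presentation. -/
def MinimalYangian.x (ε : ℤˣ) (i : Fin N) (r : Fin 2) : MinimalYangian 𝕜 p :=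
  RingQuot.mkAlgHom (PowerSeries 𝕜) (MinimalRel 𝕜 p) (fx 𝕜 p ε i r).val

end

end SuperYangian

end

/-! Every Yangian relation can be moved through the levels by commutators, so its lowest instance
suffices. Put λ = ħ/2. In the finite presentation the elements `h_{k,1} - λ h_{k,0}^2` commute and
take `x^±_{j,0}` to `±c_{kj} x^±_{j,1}`. Since c_{kj} = ±1 for neighbours, repeated commutators with
a neighbour's element define `x^±_{j,r}` for all r, and by commutativity every vertex then shifts
all levels (`lie_shiftElt_levels`). The Cartan currents are defined as `[x^+_{i,r}, x^-_{i,0}]`.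

Relations between distinct vertices: if columns i and j of the Cartan matrix are independent, a
combination of these elements raises the level of i alone and commutes with vertex j. Each relation
then spreads from level 0. The hypotheses on N and on the ends of the diagram give this independence
(`isSeparated`); for the quartic relation, two independent combinations fixing the middle vertex are
needed (`separated_triple`).

The central point is that `[x^+_{i,a}, x^-_{i,b}]` depends only on a + b (`crossBr_induction`). It
is proved jointly for two vertices i and j with c_{ij} ≠ 0: the brackets of their currents form an
arithmetic progression along each antidiagonal, and exchanging i and j forces this progression to
vanish.

For relations at a single vertex the shifts act only by the first power sum of the level shifts. A
corrected `h_{k,2}` supplies the second power sum, and together they kill the symmetric families of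
defects (`symmetric_family_eq_zero`). The relations involving currents follow by bracketing with a
root vector of opposite sign.

The two homomorphisms obtained from the presentations are mutually inverse because the generators of
the Yangian satisfy the same recursion over levels. -/

namespace SuperYangian

open SuperPresentation

/-! ### Twisted commutators in an associative algebra -/

section Bracket

variable {R A : Type*} [CommRing R] [Ring A] [Algebra R A]

/-- The twisted commutator `a b - s b a`. -/
def br (s : ℤ) (a b : A) : A := a * b - s • (b * a)

lemma br_one (a b : A) : br 1 a b = ⁅a, b⁆ := by
  rw [br, one_smul, LieRing.of_associative_ring_bracket]

lemma bracket_zero (a : A) : ⁅a, (0 : A)⁆ = 0 := by simp [LieRing.of_associative_ring_bracket]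

lemma zero_bracket (a : A) : ⁅(0 : A), a⁆ = 0 := by simp [LieRing.of_associative_ring_bracket]

lemma bracket_add (a b c : A) : ⁅a, b + c⁆ = ⁅a, b⁆ + ⁅a, c⁆ := by
  simp only [LieRing.of_associative_ring_bracket, mul_add, add_mul]; abel

lemma add_bracket (a b c : A) : ⁅a + b, c⁆ = ⁅a, c⁆ + ⁅b, c⁆ := by
  simp only [LieRing.of_associative_ring_bracket, mul_add, add_mul]; abel

lemma bracket_sub (a b c : A) : ⁅a, b - c⁆ = ⁅a, b⁆ - ⁅a, c⁆ := by
  simp only [LieRing.of_associative_ring_bracket, mul_sub, sub_mul]; abel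

lemma sub_bracket (a b c : A) : ⁅a - b, c⁆ = ⁅a, c⁆ - ⁅b, c⁆ := by
  simp only [LieRing.of_associative_ring_bracket, mul_sub, sub_mul]; abel

lemma bracket_smul (t : R) (a b : A) : ⁅a, t • b⁆ = t • ⁅a, b⁆ := by
  simp only [LieRing.of_associative_ring_bracket, mul_smul_comm, smul_mul_assoc, smul_sub]

lemma smul_bracket (t : R) (a b : A) : ⁅t • a, b⁆ = t • ⁅a, b⁆ := by
  simp only [LieRing.of_associative_ring_bracket, mul_smul_comm, smul_mul_assoc, smul_sub]

lemma bracket_antisymm (a b : A) : ⁅a, b⁆ = -⁅b, a⁆ := by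
  simp only [LieRing.of_associative_ring_bracket]; abel

lemma bracket_mul (a b c : A) : ⁅a, b * c⁆ = ⁅a, b⁆ * c + b * ⁅a, c⁆ := by
  simp only [LieRing.of_associative_ring_bracket, mul_sub, sub_mul, mul_assoc]; abel

lemma bracket_bracket (a b c : A) : ⁅a, ⁅b, c⁆⁆ = ⁅⁅a, b⁆, c⁆ + ⁅b, ⁅a, c⁆⁆ := by
  simp only [LieRing.of_associative_ring_bracket, mul_sub, sub_mul, mul_assoc]; abel

lemma lie_br (H : A) (s : ℤ) (a b : A) : ⁅H, br s a b⁆ = br s ⁅H, a⁆ b + br s a ⁅H, b⁆ := by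
  simp only [br, LieRing.of_associative_ring_bracket, mul_sub, sub_mul, mul_smul_comm,
    smul_mul_assoc, mul_assoc]
  module

lemma lie_anti (H : A) (s : ℤ) (a b : A) :
    ⁅H, a * b + s • (b * a)⁆ =
      ⁅H, a⁆ * b + s • (b * ⁅H, a⁆) + (a * ⁅H, b⁆ + s • (⁅H, b⁆ * a)) := by
  simp only [LieRing.of_associative_ring_bracket, mul_sub, sub_mul, mul_add, add_mul,
    mul_smul_comm, smul_mul_assoc, mul_assoc]
  module

lemma br_zsmul_left (s n : ℤ) (a b : A) : br s (n • a) b = n • br s a b := by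
  simp only [br, mul_smul_comm, smul_mul_assoc]; module

lemma br_zsmul_right (s n : ℤ) (a b : A) : br s a (n • b) = n • br s a b := by
  simp only [br, mul_smul_comm, smul_mul_assoc]; module

lemma br_zero_left (s : ℤ) (b : A) : br s 0 b = 0 := by simp [br]

lemma br_zero_right (s : ℤ) (a : A) : br s a 0 = 0 := by simp [br]

/-- The commutator of `[x_r, y]` with `z`, where `y` commutes with `z` up to the sign `s`. -/
lemma lie_br_sub_lie_br {s t : ℤ} (hs : s = 1 ∨ s = -1) {κ : R} {X₀ X₁ Y Z₀ Z₁ : A}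
    (hxz : br s X₁ Z₀ - br s X₀ Z₁ = κ • (X₀ * Z₀ + s • (Z₀ * X₀)))
    (h₀ : Y * Z₀ = s • (Z₀ * Y)) (h₁ : Y * Z₁ = s • (Z₁ * Y)) :
    ⁅br t X₁ Y, Z₀⁆ - ⁅br t X₀ Y, Z₁⁆ =
      κ • (br t X₀ Y * Z₀ + Z₀ * br t X₀ Y) := by
  have e₀ : Z₀ * Y = s • (Y * Z₀) := by rcases hs with rfl | rfl <;> simp [h₀]
  have e₁ : Z₁ * Y = s • (Y * Z₁) := by rcases hs with rfl | rfl <;> simp [h₁]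
  simp only [br, LieRing.of_associative_ring_bracket] at hxz ⊢
  rcases hs with rfl | rfl
  · linear_combination (norm := skip) hxz * Y - t • (Y * hxz) + X₁ * h₀ - X₀ * h₁
      + t • (e₀ * X₁) - t • (e₁ * X₀) - κ • (X₀ * h₀) + κ • t • (e₀ * X₀)
    simp only [mul_sub, sub_mul, mul_add, add_mul, mul_smul_comm, smul_mul_assoc, mul_assoc]
    module
  · linear_combination (norm := skip) -(hxz * Y) - t • (Y * hxz) + X₁ * h₀ - X₀ * h₁
      + t • (e₀ * X₁) - t • (e₁ * X₀) - κ • (X₀ * h₀) + κ • t • (e₀ * X₀)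
    simp only [mul_sub, sub_mul, mul_add, add_mul, mul_smul_comm, smul_mul_assoc, mul_assoc]
    module

/-- The second-order recursion for commutators with `[x_a, y_b]`. -/
lemma lie_br_recursion {η : R} {s : ℤ} {h₀ h₁ h₂ x₀ x₁ y₀ y₁ : A}
    (a₁ : ⁅h₂, x₀⁆ - ⁅h₁, x₁⁆ = η • (h₁ * x₀ + x₀ * h₁))
    (a₀ : ⁅h₁, x₀⁆ - ⁅h₀, x₁⁆ = η • (h₀ * x₀ + x₀ * h₀))
    (b₁ : ⁅h₂, y₀⁆ - ⁅h₁, y₁⁆ = -η • (h₁ * y₀ + y₀ * h₁))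
    (b₀ : ⁅h₁, y₀⁆ - ⁅h₀, y₁⁆ = -η • (h₀ * y₀ + y₀ * h₀)) :
    ⁅h₂, br s x₀ y₀⁆ = ⁅h₁, br s x₁ y₀ + br s x₀ y₁⁆ - ⁅h₀, br s x₁ y₁⁆
      + η ^ 2 • ⁅h₀, br s x₀ y₀⁆
      + η • (h₀ * (br s x₁ y₀ - br s x₀ y₁) + (br s x₁ y₀ - br s x₀ y₁) * h₀) := by
  simp only [br, LieRing.of_associative_ring_bracket] at *
  -- If σ, u, v raise the levels of h, x, y, this is (σ - u)(σ - v) with its η-corrections. The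
  -- Leibniz rule uses `a₁`, `b₁`; the terms with `a₀`, `b₀` and no η remove the mixed products, and
  -- those with η bring the first-order correction down to `h₀`.
  linear_combination (norm := skip) a₁ * y₀ + x₀ * b₁ - a₀ * y₁ - x₁ * b₀ + η • (a₀ * y₀)
    + η • (x₀ * b₀) - s • (y₀ * a₁ + b₁ * x₀ - y₁ * a₀ - b₀ * x₁)
    + (s • η) • (y₀ * a₀ + b₀ * x₀)
  simp only [mul_sub, sub_mul, mul_add, add_mul, mul_smul_comm, smul_mul_assoc, mul_assoc]
  module

end Bracket

/-! ### Vanishing of families indexed by levels -/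

section Propagation

variable {A : Type*}

lemma eq_zero_of_zsmul_eq_zero [AddCommGroup A] [IsAddTorsionFree A] {n : ℤ} (hn : n ≠ 0) {a : A}
    (h : n • a = 0) : a = 0 :=
  (smul_eq_zero.1 h).resolve_left hn

lemma eq_zero_of_lie_eq_zsmul_succ [Ring A] [IsAddTorsionFree A] (H : A) {d : ℤ} (hd : d ≠ 0)
    {P : ℕ → A} (hP : ∀ r, ⁅H, P r⁆ = d • P (r + 1)) (h0 : P 0 = 0) (r : ℕ) : P r = 0 := by
  induction r with
  | zero => exact h0
  | succ r ih =>
    refine eq_zero_of_zsmul_eq_zero hd ?_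
    rw [← hP, ih, bracket_zero]

/-- A symmetric family that is propagated by the first two power sums of the shifts vanishes as
soon as its first member does. -/
lemma symmetric_family_eq_zero [AddCommGroup A] [IsAddTorsionFree A] {Z : ℕ → ℕ → A}
    (hsymm : ∀ r s, Z r s = Z s r) (h0 : Z 0 0 = 0)
    (h1 : ∀ r s, Z r s = 0 → Z (r + 1) s + Z r (s + 1) = 0)
    (h2 : ∀ r s, Z r s = 0 → Z (r + 2) s + Z r (s + 2) = 0) (r s : ℕ) : Z r s = 0 := by
  have two : ∀ a : A, a + a = 0 → a = 0 := fun a ha =>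
    eq_zero_of_zsmul_eq_zero two_ne_zero (by rw [two_zsmul, ha])
  have key : ∀ n r s, r + s ≤ n → Z r s = 0 := by
    intro n
    induction n with
    | zero =>
      intro r s h
      obtain rfl : r = 0 := by omega
      obtain rfl : s = 0 := by omega
      exact h0
    | succ n ih =>
      -- The first power sum makes the entries of an antidiagonal alternate in sign, so one entry
      -- decides all. On the first antidiagonal symmetry kills it; on later ones the alternation
      -- gives `Z 2 n = Z 0 (n + 2)` and the second power sum gives the opposite sign.
      have top : Z 0 (n + 1) = 0 := by
        rcases n with _ | n
        · have h := h1 0 0 h0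
          rw [hsymm 1 0] at h
          exact two _ h
        · have e1 := h1 0 (n + 1) (ih _ _ (by omega))
          have e2 := h1 1 n (ih _ _ (by omega))
          have e3 := h2 0 n (ih _ _ (by omega))
          refine two _ ?_
          simp only [zero_add, Nat.reduceAdd, show n + 1 + 1 = n + 2 from rfl] at e1 e2 e3 ⊢
          rw [← add_zero (Z 0 (n + 2) + Z 0 (n + 2)), ← e2, ← sub_eq_zero]
          have : Z 0 (n + 2) + Z 0 (n + 2) + (Z 2 n + Z 1 (n + 1)) - (Z 2 n + Z 1 (n + 1)) =
            (Z 1 (n + 1) + Z 0 (n + 2)) + (Z 2 n + Z 0 (n + 2)) - (Z 2 n + Z 1 (n + 1)) := by abel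
          rw [this, e1, e2, e3]; simp
      have step : ∀ r s, r + s = n + 1 → Z r s = 0 := by
        intro r
        induction r with
        | zero =>
          intro s hs
          obtain rfl : s = n + 1 := by omega
          exact top
        | succ r ihr =>
          intro s hs
          have h := h1 r s (ih _ _ (by omega))
          rwa [ihr (s + 1) (by omega), add_zero] at h
      intro r s h
      rcases Nat.lt_or_ge (r + s) (n + 1) with h' | h'
      · exact ih _ _ (by omega)
      · exact step r s (by omega)
  exact key _ r s le_rfl

end Propagation

section RootDatum

variable {N : ℕ} (p : Fin (N + 1) → ZMod 2)

/-- The sign `(-1)^{|α_i| |α_j|}`. -/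
def rootSign (i j : Fin N) : ℤ := sgn (rootParity p i * rootParity p j)

lemma rootSign_comm (i j : Fin N) : rootSign p i j = rootSign p j i := by
  rw [rootSign, mul_comm, rootSign]

lemma sgn_eq_or (a : ZMod 2) : sgn a = 1 ∨ sgn a = -1 := by
  unfold sgn; split_ifs <;> simp

lemma rootSign_eq_or (i j : Fin N) : rootSign p i j = 1 ∨ rootSign p i j = -1 := sgn_eq_or _

end RootDatum

/-! ### Consequences of the finite list of relations -/

/-- A family `x^±_{i,r}` with all levels `r`, together with `h_{i,0}` and `h_{i,1}`, such that
`h_{i,1} - λ h_{i,0}^2` shifts the level and the relations of the finite presentation hold. -/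
structure CurrentSystem {R A : Type*} [CommRing R] [Ring A] [Algebra R A] {N : ℕ} (lam : R)
    (p : Fin (N + 1) → ZMod 2) (h₀ h₁ : Fin N → A) (x : ℤˣ → Fin N → ℕ → A) : Prop where
  h11 : ∀ i j, ⁅h₁ i, h₁ j⁆ = 0
  h0x : ∀ ε i j r, ⁅h₀ i, x ε j r⁆ = ((ε : ℤ) * cartan p i j) • x ε j r
  shift : ∀ ε i j r, ⁅h₁ i - lam • h₀ i ^ 2, x ε j r⁆ = ((ε : ℤ) * cartan p i j) • x ε j (r + 1)
  x00 : ∀ i, br (rootSign p i i) (x 1 i 0) (x (-1) i 0) = h₀ i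
  x10 : ∀ i, br (rootSign p i i) (x 1 i 1) (x (-1) i 0) = h₁ i
  x01 : ∀ i, br (rootSign p i i) (x 1 i 0) (x (-1) i 1) = h₁ i
  xne : ∀ i j, i ≠ j → br (rootSign p i j) (x 1 i 0) (x (-1) j 0) = 0
  xx : ∀ ε i j, ¬ (i = j ∧ rootParity p i = 1) →
    br (rootSign p i j) (x ε i 1) (x ε j 0) - br (rootSign p i j) (x ε i 0) (x ε j 1) =
      ((ε : ℤ) * cartan p i j) • lam • (x ε i 0 * x ε j 0 + rootSign p i j • (x ε j 0 * x ε i 0))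
  xzero : ∀ ε i j, cartan p i j = 0 → br (rootSign p i j) (x ε i 0) (x ε j 0) = 0

namespace CurrentSystem

variable {R A : Type*} [CommRing R] [Ring A] [Algebra R A] {N : ℕ} {lam : R}
  {p : Fin (N + 1) → ZMod 2} {h₀ h₁ : Fin N → A} {x : ℤˣ → Fin N → ℕ → A}

/-! ### Relations between distinct vertices -/

section Separation

variable {i j : Fin N}

/-- If two columns of the Cartan matrix are independent, some element shifts the level of one
of the two vertices and commutes with the other. -/
lemma exists_separating (S : CurrentSystem lam p h₀ h₁ x)
    (hsep : ∃ k l, cartan p k i * cartan p l j - cartan p l i * cartan p k j ≠ 0) :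
    ∃ H : A, ∃ d : ℤ, d ≠ 0 ∧ (∀ ε r, ⁅H, x ε i r⁆ = (ε * d) • x ε i (r + 1)) ∧
      ∀ ε r, ⁅H, x ε j r⁆ = 0 := by
  obtain ⟨k, l, hd⟩ := hsep
  -- The coefficients cancel the action on vertex j; on vertex i they leave the 2 × 2 minor of rows
  -- k, l and columns i, j.
  refine ⟨cartan p l j • (h₁ k - lam • h₀ k ^ 2) - cartan p k j • (h₁ l - lam • h₀ l ^ 2), _, hd,
    fun ε r => ?_, fun ε r => ?_⟩ <;>
  · rw [sub_bracket, smul_bracket, smul_bracket, S.shift, S.shift]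
    module

lemma separation_symm
    (hsep : ∃ k l, cartan p k i * cartan p l j - cartan p l i * cartan p k j ≠ 0) :
    ∃ k l, cartan p k j * cartan p l i - cartan p l j * cartan p k i ≠ 0 := by
  obtain ⟨k, l, hd⟩ := hsep
  exact ⟨l, k, by convert hd using 1; ring⟩

lemma units_mul_ne_zero (ε : ℤˣ) {d : ℤ} (hd : d ≠ 0) : (ε : ℤ) * d ≠ 0 :=
  mul_ne_zero ε.ne_zero hd

/-- The defect of the quadratic relation between `x^±_{i,r}` and `x^±_{j,s}`. -/
def quadraticDefect (lam : R) (p : Fin (N + 1) → ZMod 2) (x : ℤˣ → Fin N → ℕ → A)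
    (ε : ℤˣ) (i j : Fin N) (r s : ℕ) : A :=
  br (rootSign p i j) (x ε i (r + 1)) (x ε j s) - br (rootSign p i j) (x ε i r) (x ε j (s + 1)) -
    ((ε : ℤ) * cartan p i j) • lam • (x ε i r * x ε j s + rootSign p i j • (x ε j s * x ε i r))

lemma lie_quadraticDefect {ε : ℤˣ} {a b : ℤ} {H : A}
    (hi : ∀ r, ⁅H, x ε i r⁆ = a • x ε i (r + 1)) (hj : ∀ r, ⁅H, x ε j r⁆ = b • x ε j (r + 1))
    (r s : ℕ) :
    ⁅H, quadraticDefect lam p x ε i j r s⁆ = a • quadraticDefect lam p x ε i j (r + 1) s +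
      b • quadraticDefect lam p x ε i j r (s + 1) := by
  simp only [quadraticDefect, bracket_sub, bracket_smul, lie_br, lie_anti, hi, hj]
  simp only [br, mul_smul_comm, smul_mul_assoc]
  module

variable [IsAddTorsionFree A]

/-- The level-zero relation is moved first in r, then in s, by elements that each shift one vertex
only. The next two vanishing lemmas follow the same scheme. -/
lemma br_pos_neg_eq_zero (S : CurrentSystem lam p h₀ h₁ x) (hij : i ≠ j)
    (hsep : ∃ k l, cartan p k i * cartan p l j - cartan p l i * cartan p k j ≠ 0) (r s : ℕ) :
    br (rootSign p i j) (x 1 i r) (x (-1) j s) = 0 := by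
  obtain ⟨H, d, hd, hi, hj⟩ := S.exists_separating hsep
  obtain ⟨H', d', hd', hj', hi'⟩ := S.exists_separating (separation_symm hsep)
  refine eq_zero_of_lie_eq_zsmul_succ H' (units_mul_ne_zero (-1) hd')
    (P := fun s => br (rootSign p i j) (x 1 i r) (x (-1) j s)) (fun s => ?_) ?_ s
  · rw [lie_br, hi', hj', br_zero_left, br_zsmul_right, zero_add]
  refine eq_zero_of_lie_eq_zsmul_succ H (units_mul_ne_zero 1 hd)
    (P := fun r => br (rootSign p i j) (x 1 i r) (x (-1) j 0)) (fun r => ?_) (S.xne i j hij) r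
  rw [lie_br, hi, hj, br_zero_right, br_zsmul_left, add_zero]

lemma br_eq_zero_of_ne (S : CurrentSystem lam p h₀ h₁ x) (hc : cartan p i j = 0)
    (hsep : ∃ k l, cartan p k i * cartan p l j - cartan p l i * cartan p k j ≠ 0) (ε : ℤˣ)
    (r s : ℕ) : br (rootSign p i j) (x ε i r) (x ε j s) = 0 := by
  obtain ⟨H, d, hd, hi, hj⟩ := S.exists_separating hsep
  obtain ⟨H', d', hd', hj', hi'⟩ := S.exists_separating (separation_symm hsep)
  refine eq_zero_of_lie_eq_zsmul_succ H' (units_mul_ne_zero ε hd')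
    (P := fun s => br (rootSign p i j) (x ε i r) (x ε j s)) (fun s => ?_) ?_ s
  · rw [lie_br, hi', hj', br_zero_left, br_zsmul_right, zero_add]
  refine eq_zero_of_lie_eq_zsmul_succ H (units_mul_ne_zero ε hd)
    (P := fun r => br (rootSign p i j) (x ε i r) (x ε j 0)) (fun r => ?_) (S.xzero ε i j hc) r
  rw [lie_br, hi, hj, br_zero_right, br_zsmul_left, add_zero]

lemma quadraticDefect_eq_zero_of_ne (S : CurrentSystem lam p h₀ h₁ x) (hij : i ≠ j)
    (hsep : ∃ k l, cartan p k i * cartan p l j - cartan p l i * cartan p k j ≠ 0) (ε : ℤˣ)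
    (r s : ℕ) : quadraticDefect lam p x ε i j r s = 0 := by
  obtain ⟨H, d, hd, hi, hj⟩ := S.exists_separating hsep
  obtain ⟨H', d', hd', hj', hi'⟩ := S.exists_separating (separation_symm hsep)
  refine eq_zero_of_lie_eq_zsmul_succ H' (units_mul_ne_zero ε hd')
    (P := fun s => quadraticDefect lam p x ε i j r s) (fun s => ?_) ?_ s
  · rw [lie_quadraticDefect (a := 0) (fun r => by rw [hi', zero_smul]) (hj' ε), zero_smul,
      zero_add]
  refine eq_zero_of_lie_eq_zsmul_succ H (units_mul_ne_zero ε hd)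
    (P := fun r => quadraticDefect lam p x ε i j r 0) (fun r => ?_) ?_ r
  · rw [lie_quadraticDefect (b := 0) (hi ε) (fun r => by rw [hj, zero_smul]), zero_smul, add_zero]
  · exact sub_eq_zero.2 (S.xx ε i j fun h => hij h.1)

end Separation

end CurrentSystem

namespace CurrentSystem

variable {R A : Type*} [CommRing R] [Ring A] [Algebra R A] {N : ℕ} {lam : R}
  {p : Fin (N + 1) → ZMod 2} {h₀ h₁ : Fin N → A} {x : ℤˣ → Fin N → ℕ → A}

/-! ### Commutators of opposite root vectors at one vertex -/

section Currents

/-- The commutator `[x^+_{i,a}, x^-_{i,b}]`. -/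
def crossBr (p : Fin (N + 1) → ZMod 2) (x : ℤˣ → Fin N → ℕ → A) (i : Fin N) (a b : ℕ) : A :=
  br (rootSign p i i) (x 1 i a) (x (-1) i b)

variable {i j : Fin N}

lemma units_val_one : ((1 : ℤˣ) : ℤ) = 1 := rfl

lemma units_val_neg_one : ((-1 : ℤˣ) : ℤ) = -1 := rfl

lemma lie_h0_crossBr (S : CurrentSystem lam p h₀ h₁ x) (k i : Fin N) (a b : ℕ) :
    ⁅h₀ k, crossBr p x i a b⁆ = 0 := by
  rw [crossBr, lie_br, S.h0x, S.h0x, br_zsmul_left, br_zsmul_right]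
  simp

lemma lie_shift_crossBr (S : CurrentSystem lam p h₀ h₁ x) (k i : Fin N) (a b : ℕ) :
    ⁅h₁ k - lam • h₀ k ^ 2, crossBr p x i a b⁆ =
      cartan p k i • (crossBr p x i (a + 1) b - crossBr p x i a (b + 1)) := by
  rw [crossBr, lie_br, S.shift, S.shift, br_zsmul_left, br_zsmul_right]
  rw [units_val_one, units_val_neg_one, crossBr, crossBr]
  module

lemma lie_h1_crossBr (S : CurrentSystem lam p h₀ h₁ x) (k i : Fin N) (a b : ℕ) :
    ⁅h₁ k, crossBr p x i a b⁆ =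
      cartan p k i • (crossBr p x i (a + 1) b - crossBr p x i a (b + 1)) := by
  have h : ⁅h₀ k ^ 2, crossBr p x i a b⁆ = 0 := by
    rw [bracket_antisymm, pow_two, bracket_mul, bracket_antisymm, S.lie_h0_crossBr]
    simp
  rw [← S.lie_shift_crossBr, sub_bracket, smul_bracket, h, smul_zero, sub_zero]

variable [IsAddTorsionFree A]

/-- Bracketing the quadratic relation between `x^+_i` and `x^+_j` with `x^-_{i,0}` gives this, since
`x^-_{i,0}` supercommutes with every `x^+_{j,s}`. -/
lemma lie_crossBr_pos (S : CurrentSystem lam p h₀ h₁ x) (hij : i ≠ j)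
    (hsep : ∃ k l, cartan p k i * cartan p l j - cartan p l i * cartan p k j ≠ 0) (r s : ℕ) :
    ⁅crossBr p x i (r + 1) 0, x 1 j s⁆ - ⁅crossBr p x i r 0, x 1 j (s + 1)⁆ =
      (cartan p i j • lam) • (crossBr p x i r 0 * x 1 j s + x 1 j s * crossBr p x i r 0) := by
  have hz : ∀ s, x (-1) i 0 * x 1 j s = rootSign p i j • (x 1 j s * x (-1) i 0) := by
    intro s
    have h := S.br_pos_neg_eq_zero hij.symm (separation_symm hsep) s 0
    rw [br, sub_eq_zero, rootSign_comm] at h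
    rw [h]
    rcases rootSign_eq_or p i j with h | h <;> rw [h] <;> simp
  refine lie_br_sub_lie_br (rootSign_eq_or p i j) ?_ (hz s) (hz (s + 1))
  have h := S.quadraticDefect_eq_zero_of_ne hij hsep 1 r s
  rw [quadraticDefect, sub_eq_zero] at h
  rw [h, units_val_one, one_mul, smul_assoc]

/-- Here the quadratic relation moves levels of `x^-_i`, so the level must sit in the second slot of
`crossBr`. Identifying this with a current requires antidiagonal constancy. -/
lemma lie_crossBr_neg (S : CurrentSystem lam p h₀ h₁ x) (hij : i ≠ j)
    (hsep : ∃ k l, cartan p k i * cartan p l j - cartan p l i * cartan p k j ≠ 0) (r s : ℕ) :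
    ⁅crossBr p x i 0 (r + 1), x (-1) j s⁆ - ⁅crossBr p x i 0 r, x (-1) j (s + 1)⁆ =
      -(cartan p i j • lam) •
        (crossBr p x i 0 r * x (-1) j s + x (-1) j s * crossBr p x i 0 r) := by
  have hz : ∀ s, x 1 i 0 * x (-1) j s = rootSign p i j • (x (-1) j s * x 1 i 0) := fun s =>
    sub_eq_zero.1 (S.br_pos_neg_eq_zero hij hsep 0 s)
  have h := S.quadraticDefect_eq_zero_of_ne hij hsep (-1) r s
  rw [quadraticDefect, sub_eq_zero] at h
  have key := lie_br_sub_lie_br (κ := -(cartan p i j • lam)) (t := rootSign p i i)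
    (rootSign_eq_or p i j)
    (h.trans (by rw [units_val_neg_one]; module)) (hz s) (hz (s + 1))
  have e : ∀ r, crossBr p x i 0 r =
      (-rootSign p i i) • br (rootSign p i i) (x (-1) i r) (x 1 i 0) := by
    intro r
    rw [crossBr, br, br]
    rcases rootSign_eq_or p i i with h | h <;> rw [h] <;> module
  rw [e, e, smul_bracket, smul_bracket, ← smul_sub, key]
  simp only [smul_mul_assoc, mul_smul_comm]
  module

/-- Along an antidiagonal the commutators of `[x^+_{i,a}, x^-_{i,b}]` and
`[x^+_{j,a}, x^-_{j,b}]` form an arithmetic progression. -/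
lemma lie_crossBr_antidiagonal (S : CurrentSystem lam p h₀ h₁ x) (hij : i ≠ j)
    (hsep : ∃ k l, cartan p k i * cartan p l j - cartan p l i * cartan p k j ≠ 0) {n : ℕ}
    (hi : ∀ a b, a + b ≤ n → crossBr p x i a b = crossBr p x i (a + b) 0)
    (hj : ∀ a b, a + b ≤ n → crossBr p x j a b = crossBr p x j (a + b) 0)
    (hcomm : ∀ r s, r + s ≤ n → ⁅crossBr p x i r 0, crossBr p x j s 0⁆ = 0) (r m : ℕ)
    (hrm : r + m + 1 = n) :
    ⁅crossBr p x i (r + 1) 0, crossBr p x j (m + 1) 0⁆ =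
      ((r : ℤ) + 1) • ⁅crossBr p x i 1 0, crossBr p x j n 0⁆ := by
  have neg : ∀ r s, r + 1 ≤ n → ⁅crossBr p x i (r + 1) 0, x (-1) j s⁆ -
      ⁅crossBr p x i r 0, x (-1) j (s + 1)⁆ = -(cartan p i j • lam) •
        (crossBr p x i r 0 * x (-1) j s + x (-1) j s * crossBr p x i r 0) := by
    intro r s h
    have := S.lie_crossBr_neg hij hsep r s
    rwa [hi 0 (r + 1) (by omega), hi 0 r (by omega), zero_add, zero_add] at this
  -- In `lie_br_recursion` the η-terms drop out by the inductive hypotheses, leaving a vanishing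
  -- second difference along the antidiagonal. The last term is kept as `crossBr p x j (m + 1) 1`
  -- because for r = 0 its total level m + 2 exceeds n; there `h_{i,0}` commutes with it anyway.
  have recur : ∀ r m, r + m + 1 = n → r + 2 ≤ n →
      ⁅crossBr p x i (r + 2) 0, crossBr p x j m 0⁆ =
        (2 : ℤ) • ⁅crossBr p x i (r + 1) 0, crossBr p x j (m + 1) 0⁆ -
          ⁅crossBr p x i r 0, crossBr p x j (m + 1) 1⁆ := by
    intro r m h h'
    have key := lie_br_recursion (s := rootSign p j j)
      (S.lie_crossBr_pos hij hsep (r + 1) m) (S.lie_crossBr_pos hij hsep r m)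
      (neg (r + 1) 0 (by omega)) (neg r 0 (by omega))
    have fold : ∀ a b, br (rootSign p j j) (x 1 j a) (x (-1) j b) = crossBr p x j a b :=
      fun _ _ => rfl
    simp only [fold, zero_add] at key
    rw [hj m 1 (by omega), hcomm r m (by omega)] at key
    rw [key, bracket_add]
    simp [two_smul]
  induction r using Nat.twoStepInduction generalizing m with
  | zero =>
    obtain rfl : m + 1 = n := by omega
    simp
  | one =>
    have := recur 0 (m + 1) (by omega) (by omega)
    rw [this]
    have h0 : crossBr p x i 0 0 = h₀ i := S.x00 i
    obtain rfl : m + 1 + 1 = n := by omega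
    rw [h0, S.lie_h0_crossBr]
    simp
  | more r ih0 ih1 =>
    have := recur (r + 1) (m + 1) (by omega) (by omega)
    rw [this, hj (m + 2) 1 (by omega), ih1 (m + 1) (by omega), ih0 (m + 2) (by omega)]
    push_cast
    module

/-- Induction on the total level n. If the bracket of `h_{k,1}` with the current of level n
vanishes, then antidiagonal n + 1 is constant, because that bracket is a nonzero multiple of each
difference of adjacent entries. The bracket vanishes by comparing the arithmetic progressions for
(i, j) and (j, i). -/
lemma crossBr_induction (S : CurrentSystem lam p h₀ h₁ x) (hij : i ≠ j) (hc : cartan p i j ≠ 0)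
    (hc' : cartan p j i ≠ 0)
    (hsep : ∃ k l, cartan p k i * cartan p l j - cartan p l i * cartan p k j ≠ 0) (n : ℕ)
    (hn : 1 ≤ n) :
    (∀ a b, a + b ≤ n → crossBr p x i a b = crossBr p x i (a + b) 0) ∧
    (∀ a b, a + b ≤ n → crossBr p x j a b = crossBr p x j (a + b) 0) ∧
    (∀ r s, r + s ≤ n → ⁅crossBr p x i r 0, crossBr p x j s 0⁆ = 0) := by
  have level1 : ∀ i a b, a + b ≤ 1 → crossBr p x i a b = crossBr p x i (a + b) 0 := by
    intro i a b hab
    rcases b with _ | b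
    · rfl
    · obtain rfl : a = 0 := by omega
      obtain rfl : b = 0 := by omega
      exact (S.x01 i).trans (S.x10 i).symm
  have zero : ∀ i, crossBr p x i 0 0 = h₀ i := S.x00
  have one : ∀ i, crossBr p x i 1 0 = h₁ i := S.x10
  have extend : ∀ i k n, cartan p k i ≠ 0 →
      (∀ a b, a + b ≤ n → crossBr p x i a b = crossBr p x i (a + b) 0) →
      ⁅h₁ k, crossBr p x i n 0⁆ = 0 →
      ∀ a b, a + b ≤ n + 1 → crossBr p x i a b = crossBr p x i (a + b) 0 := by
    intro i k n hk hi h a b hab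
    rcases Nat.lt_or_ge (a + b) (n + 1) with h' | h'
    · exact hi a b (by omega)
    · induction b generalizing a with
      | zero => rfl
      | succ b ih =>
        have e := S.lie_h1_crossBr k i a b
        rw [hi a b (by omega), show a + b = n by omega, h] at e
        have e' := eq_zero_of_zsmul_eq_zero hk e.symm
        rw [sub_eq_zero] at e'
        rw [← e', ih (a + 1) (by omega) (by omega)]
        congr 1
        omega
  induction n, hn using Nat.le_induction with
  | base =>
    refine ⟨level1 i, level1 j, fun r s hrs => ?_⟩
    rcases r with _ | r
    · rw [zero, S.lie_h0_crossBr]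
    · obtain rfl : s = 0 := by omega
      rw [zero, bracket_antisymm, S.lie_h0_crossBr, neg_zero]
  | succ n hn ih =>
    obtain ⟨hi, hj, hcomm⟩ := ih
    have hcomm' : ∀ r s, r + s ≤ n → ⁅crossBr p x j r 0, crossBr p x i s 0⁆ = 0 := fun r s h => by
      rw [bracket_antisymm, hcomm s r (by omega), neg_zero]
    have d := S.lie_crossBr_antidiagonal hij hsep hi hj hcomm
    have d' := S.lie_crossBr_antidiagonal hij.symm (separation_symm hsep) hj hi hcomm'
    -- For n = 1 this is a given relation. Otherwise let c be this bracket: the progression for (i,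
    -- j) gives n c for the bracket of level n at i with level 1 at j, and the one for (j, i) then
    -- gives c = n² c. With n = m + 1 the factor n² - 1 is m(m + 2).
    have vanish : ⁅h₁ i, crossBr p x j n 0⁆ = 0 := by
      rw [← one]
      rcases Nat.eq_or_lt_of_le hn with rfl | hn2
      · rw [one, one, S.h11]
      obtain ⟨m, rfl⟩ : ∃ m, n = m + 1 := ⟨n - 1, by omega⟩
      have e := d m 0 (by omega)
      have e' := d' m 0 (by omega)
      rw [zero_add] at e e'
      rw [bracket_antisymm (crossBr p x j (m + 1) 0), bracket_antisymm (crossBr p x j 1 0), e]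
        at e'
      refine eq_zero_of_zsmul_eq_zero (n := (m : ℤ) * (m + 2)) (by
        have : (0 : ℤ) < m := by omega
        positivity) ?_
      linear_combination (norm := module) e'
    have dz : ∀ r m, r + m + 1 = n → ⁅crossBr p x i (r + 1) 0, crossBr p x j (m + 1) 0⁆ = 0 := by
      intro r m h
      rw [d r m h, one, vanish, smul_zero]
    refine ⟨extend i j n hc' hi ?_, extend j i n hc hj vanish, ?_⟩
    · obtain ⟨m, rfl⟩ : ∃ m, n = m + 1 := ⟨n - 1, by omega⟩
      rw [bracket_antisymm, ← one, dz m 0 (by omega), neg_zero]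
    · intro r s h
      rcases r with _ | r
      · rw [zero, S.lie_h0_crossBr]
      rcases s with _ | s
      · rw [zero, bracket_antisymm, S.lie_h0_crossBr, neg_zero]
      rcases Nat.lt_or_ge (r + 1 + (s + 1)) (n + 1) with h' | h'
      · exact hcomm _ _ (by omega)
      · exact dz r s (by omega)

end Currents

end CurrentSystem

/-! ### Identities for relations at a single vertex -/

section Algebra

variable {R A : Type*} [CommRing R] [Ring A] [Algebra R A]

/-- The quadratic correction of `3 h_2` acts on the `x_r` by a combination of level shifts. -/
lemma bracket_cubic_cartan {lam : R} {γ : ℤ} {h₀ h₁ h₂ x₀ x₁ x₂ : A}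
    (e₀ : ⁅h₀, x₀⁆ = γ • x₀)
    (a₀ : ⁅h₁, x₀⁆ - γ • x₁ = (γ • lam) • (h₀ * x₀ + x₀ * h₀))
    (a₁ : ⁅h₁, x₁⁆ - γ • x₂ = (γ • lam) • (h₀ * x₁ + x₁ * h₀))
    (a₂ : ⁅h₂, x₀⁆ - ⁅h₁, x₁⁆ = (γ • lam) • (h₁ * x₀ + x₀ * h₁)) :
    ⁅(3 : ℤ) • h₂ - ((3 : ℤ) • lam) • (h₀ * h₁ + h₁ * h₀) + ((4 : ℤ) • lam ^ 2) • h₀ ^ 3, x₀⁆ =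
      (3 * γ) • x₂ + (γ ^ 3 • lam ^ 2) • x₀ := by
  simp only [LieRing.of_associative_ring_bracket] at *
  linear_combination (norm := skip) (3 : ℤ) • a₂ + (3 : ℤ) • a₁
    - ((3 : ℤ) • lam) • (h₀ * a₀ + a₀ * h₀) - ((3 : ℤ) • lam) • (h₁ * e₀ + e₀ * h₁)
    + ((4 : ℤ) • lam ^ 2) • (h₀ * h₀ * e₀ + h₀ * e₀ * h₀ + e₀ * (h₀ * h₀))
    + (γ • lam ^ 2) • (h₀ * e₀ - e₀ * h₀ + γ • e₀)
  simp only [pow_succ, pow_zero, one_mul, mul_sub, sub_mul, mul_add, add_mul, mul_smul_comm,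
    smul_mul_assoc, mul_assoc]
  module

lemma bracket_sub_smul_sq {lam : R} {γ : ℤ} {h₀ h₁ x₀ x₁ : A} (e : ⁅h₀, x₀⁆ = γ • x₀)
    (f : ⁅h₁, x₀⁆ - γ • x₁ = γ • lam • (h₀ * x₀ + x₀ * h₀)) :
    ⁅h₁ - lam • h₀ ^ 2, x₀⁆ = γ • x₁ := by
  simp only [LieRing.of_associative_ring_bracket] at *
  linear_combination (norm := skip) f - lam • (h₀ * e + e * h₀)
  simp only [pow_two, mul_sub, sub_mul, mul_smul_comm, smul_mul_assoc, mul_assoc]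
  module

/-- The defect of the relation between h and x is antisymmetric in r and s, because the quadratic
relation bracketed with `y` is the sum of the two defects. Taking s = 0 reduces a general current to
`h 0` and `h 1`. -/
lemma bracket_swap_of_quadratic {η : R} {h : ℕ → A} {x : ℕ → A} {y : A} {r s : ℕ}
    (hh : ∀ a, h a = ⁅x a, y⁆)
    (hxx : ⁅x (r + 1), x s⁆ - ⁅x r, x (s + 1)⁆ = η • (x r * x s + x s * x r)) :
    ⁅h (r + 1), x s⁆ - ⁅h r, x (s + 1)⁆ - η • (h r * x s + x s * h r) =
      -(⁅h (s + 1), x r⁆ - ⁅h s, x (r + 1)⁆ - η • (h s * x r + x r * h s)) := by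
  simp only [hh, LieRing.of_associative_ring_bracket] at *
  linear_combination (norm := skip) hxx * y - y * hxx
  simp only [mul_sub, sub_mul, mul_add, add_mul, mul_smul_comm, smul_mul_assoc, mul_assoc]
  module

/-- The odd analogue: the supercommutator of `x r` and `x s`, bracketed with `y`, is the sum of the
two brackets up to sign. -/
lemma bracket_swap_of_anticommute {h : ℕ → A} {x : ℕ → A} {y : A} {r s : ℕ}
    (hh : ∀ a, h a = br (-1) (x a) y) (hxx : br (-1) (x r) (x s) = 0) :
    ⁅h r, x s⁆ = -⁅h s, x r⁆ := by
  simp only [hh, br, LieRing.of_associative_ring_bracket] at hxx ⊢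
  linear_combination (norm := skip) y * hxx - hxx * y
  simp only [mul_sub, sub_mul, mul_smul_comm, smul_mul_assoc, mul_assoc, mul_zero, zero_mul]
  module

lemma lie_br_shift {H : A} {m : ℕ} {a : ℤ} {b : R} {x : ℕ → A}
    (hx : ∀ r, ⁅H, x r⁆ = a • x (r + m) + b • x r) (t : ℤ) (r s : ℕ) :
    ⁅H, br t (x r) (x s)⁆ = a • (br t (x (r + m)) (x s) + br t (x r) (x (s + m))) +
      ((2 : ℤ) • b) • br t (x r) (x s) := by
  simp only [lie_br, hx]
  simp only [br, mul_add, add_mul, mul_smul_comm, smul_mul_assoc]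
  module

/-- The symmetrized triple commutator of the cubic relations. -/
def serre (x y : ℕ → A) (r s t : ℕ) : A := ⁅x r, ⁅x s, y t⁆⁆ + ⁅x s, ⁅x r, y t⁆⁆

lemma lie_serre_shift {H : A} {m : ℕ} {a a' : ℤ} {b b' : R} {x y : ℕ → A}
    (hx : ∀ r, ⁅H, x r⁆ = a • x (r + m) + b • x r)
    (hy : ∀ r, ⁅H, y r⁆ = a' • y (r + m) + b' • y r) (r s t : ℕ) :
    ⁅H, serre x y r s t⁆ = a • (serre x y (r + m) s t + serre x y r (s + m) t) +
      a' • serre x y r s (t + m) + ((2 : ℤ) • b + b') • serre x y r s t := by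
  have key : ∀ r s t, ⁅H, ⁅x r, ⁅x s, y t⁆⁆⁆ = a • (⁅x (r + m), ⁅x s, y t⁆⁆ +
      ⁅x r, ⁅x (s + m), y t⁆⁆) + a' • ⁅x r, ⁅x s, y (t + m)⁆⁆ +
        ((2 : ℤ) • b + b') • ⁅x r, ⁅x s, y t⁆⁆ := by
    intro r s t
    rw [bracket_bracket H, bracket_bracket H, hx, hx, hy]
    simp only [add_bracket, bracket_add, smul_bracket, bracket_smul]
    module
  simp only [serre, bracket_add, key]
  module

end Algebra

section RootDatum

variable {N : ℕ} {p : Fin (N + 1) → ZMod 2}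

lemma cartan_comm (i j : Fin N) : cartan p i j = cartan p j i := by
  simp only [cartan, form]
  exact Finset.sum_congr rfl fun k _ => by ring

lemma rootSign_self_even {i : Fin N} (hi : rootParity p i = 0) : rootSign p i i = 1 := by
  simp [rootSign, hi, sgn]

lemma rootSign_self_odd {i : Fin N} (hi : rootParity p i = 1) : rootSign p i i = -1 := by
  simp [rootSign, hi, sgn]

variable (p) in
/-- Any two columns of the Cartan matrix are independent, and every vertex is joined to another
one. -/
structure IsSeparated : Prop where
  sep : ∀ i j, i ≠ j → ∃ k l, cartan p k i * cartan p l j - cartan p l i * cartan p k j ≠ 0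
  nbr : ∀ i, ∃ k, k ≠ i ∧ cartan p k i ≠ 0

end RootDatum

/-! ### The full list of relations at all levels -/

namespace CurrentSystem

variable {R A : Type*} [CommRing R] [Ring A] [Algebra R A] {N : ℕ} {lam : R}
  {p : Fin (N + 1) → ZMod 2} {h₀ h₁ : Fin N → A} {x : ℤˣ → Fin N → ℕ → A}

lemma lie_h1_x (S : CurrentSystem lam p h₀ h₁ x) (ε : ℤˣ) (i j : Fin N) (s : ℕ) :
    ⁅h₁ i, x ε j s⁆ - ((ε : ℤ) * cartan p i j) • x ε j (s + 1) =
      (((ε : ℤ) * cartan p i j) • lam) • (h₀ i * x ε j s + x ε j s * h₀ i) := by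
  have e := S.h0x ε i j s
  have f := S.shift ε i j s
  simp only [LieRing.of_associative_ring_bracket] at *
  linear_combination (norm := skip) f + lam • (h₀ i * e + e * h₀ i)
  simp only [pow_two, mul_sub, sub_mul, mul_smul_comm, smul_mul_assoc, mul_assoc]
  module

/-- The current `h_{i,r}`, namely `[x^+_{i,r}, x^-_{i,0}]`. -/
abbrev current (p : Fin (N + 1) → ZMod 2) (x : ℤˣ → Fin N → ℕ → A) (i : Fin N) (r : ℕ) : A :=
  crossBr p x i r 0

lemma current_zero (S : CurrentSystem lam p h₀ h₁ x)
    (i : Fin N) : current p x i 0 = h₀ i := S.x00 i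

lemma current_one (S : CurrentSystem lam p h₀ h₁ x)
    (i : Fin N) : current p x i 1 = h₁ i := S.x10 i

/-- An element acting on level shifts as the second power sum, provided `h_{k,2}` acts on the
elements `x^±_{j,s}` as it should. -/
lemma exists_double_shift (S : CurrentSystem lam p h₀ h₁ x)
    (k : Fin N) : ∃ U : A, ∀ j,
    (∀ ε s, ⁅current p x k 2, x ε j s⁆ - ⁅current p x k 1, x ε j (s + 1)⁆ =
      (((ε : ℤ) * cartan p k j) • lam) •
        (current p x k 1 * x ε j s + x ε j s * current p x k 1)) →
    ∀ ε s, ⁅U, x ε j s⁆ = (3 * ((ε : ℤ) * cartan p k j)) • x ε j (s + 2) +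
      (((ε : ℤ) * cartan p k j) ^ 3 • lam ^ 2) • x ε j s := by
  -- With ħ = 2λ, the witness is three times the z⁻³ coefficient of ħ⁻¹ log(1 + ħ Σ h_r z^{-r-1}),
  -- whose z⁻² coefficient is the level-one shift element. The factor 3 clears the denominator.
  refine ⟨_, fun j hj ε s => bracket_cubic_cartan (h₂ := current p x k 2)
    (S.h0x ε k j s) (S.lie_h1_x ε k j s) (S.lie_h1_x ε k j (s + 1)) ?_⟩
  have := hj ε s
  rwa [S.current_one] at this

variable [IsAddTorsionFree A]

lemma crossBr_eq_current (S : CurrentSystem lam p h₀ h₁ x) (hp : IsSeparated p)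
    (i : Fin N) (a b : ℕ) : crossBr p x i a b = current p x i (a + b) := by
  obtain ⟨k, hk, hc⟩ := hp.nbr i
  have hc' : cartan p i k ≠ 0 := by rwa [cartan_comm]
  -- The bound a + b + 1 is used rather than a + b because the induction starts at level 1.
  exact (S.crossBr_induction hk.symm hc' hc (hp.sep _ _ hk.symm) (a + b + 1) (by omega)).1 a b
    (by omega)

lemma lie_h1_current (S : CurrentSystem lam p h₀ h₁ x) (hp : IsSeparated p)
    (k i : Fin N) (r : ℕ) : ⁅h₁ k, current p x i r⁆ = 0 := by
  rw [current, S.lie_h1_crossBr, S.crossBr_eq_current hp, S.crossBr_eq_current hp]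
  simp

lemma lie_shift_current (S : CurrentSystem lam p h₀ h₁ x) (hp : IsSeparated p)
    (k i : Fin N) (r : ℕ) :
    ⁅h₁ k - lam • h₀ k ^ 2, current p x i r⁆ = 0 := by
  rw [current, S.lie_shift_crossBr, S.crossBr_eq_current hp, S.crossBr_eq_current hp]
  simp

lemma lie_current_of_ne (S : CurrentSystem lam p h₀ h₁ x) (hp : IsSeparated p)
    {i j : Fin N} (hij : i ≠ j) (ε : ℤˣ) (r s : ℕ) :
    ⁅current p x i (r + 1), x ε j s⁆ - ⁅current p x i r, x ε j (s + 1)⁆ =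
      (((ε : ℤ) * cartan p i j) • lam) •
        (current p x i r * x ε j s + x ε j s * current p x i r) := by
  rcases Int.units_eq_one_or ε with rfl | rfl
  · have h := S.lie_crossBr_pos hij (hp.sep i j hij) r s
    rwa [units_val_one, one_mul]
  · have h := S.lie_crossBr_neg hij (hp.sep i j hij) r s
    rw [S.crossBr_eq_current hp, S.crossBr_eq_current hp, zero_add, zero_add] at h
    rw [h, units_val_neg_one, neg_one_mul, neg_smul (cartan p i j) lam]

/-- For even i the defect is symmetric in r and s. Both power sums come from a vertex k ≠ i with
c_{ki} ≠ 0, so only relations between distinct vertices are needed and there is no circularity. -/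
lemma quadraticDefect_eq_zero_of_even (S : CurrentSystem lam p h₀ h₁ x) (hp : IsSeparated p)
    {i : Fin N} (hi : rootParity p i = 0) (ε : ℤˣ) (r s : ℕ) :
    quadraticDefect lam p x ε i i r s = 0 := by
  obtain ⟨k, hk, hc⟩ := hp.nbr i
  have hεc := units_mul_ne_zero ε hc
  obtain ⟨U, hU⟩ := S.exists_double_shift k
  have hU' := hU i fun ε s => S.lie_current_of_ne hp hk ε 1 s
  refine symmetric_family_eq_zero (Z := quadraticDefect lam p x ε i i) (fun r s => ?_) ?_
    (fun r s h => ?_) (fun r s h => ?_) r s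
  · simp only [quadraticDefect, br, rootSign_self_even hi]
    module
  · exact sub_eq_zero.2 (S.xx ε i i fun h => by simp [hi] at h)
  · refine eq_zero_of_zsmul_eq_zero hεc ?_
    rw [smul_add, ← lie_quadraticDefect (S.shift ε k i) (S.shift ε k i), h, bracket_zero]
  · have e : ⁅U, quadraticDefect lam p x ε i i r s⁆ = (3 * ((ε : ℤ) * cartan p k i)) •
      (quadraticDefect lam p x ε i i (r + 2) s + quadraticDefect lam p x ε i i r (s + 2)) +
        ((2 : ℤ) • (((ε : ℤ) * cartan p k i) ^ 3 • lam ^ 2)) •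
          quadraticDefect lam p x ε i i r s := by
      simp only [quadraticDefect, bracket_sub, bracket_smul, lie_br, lie_anti, hU' ε]
      simp only [br, mul_add, add_mul, mul_smul_comm, smul_mul_assoc]
      simp only [show ∀ a, a + 1 + 2 = a + 2 + 1 from fun a => by omega]
      module
    rw [h, bracket_zero, smul_zero, add_zero] at e
    exact eq_zero_of_zsmul_eq_zero (mul_ne_zero three_ne_zero hεc) e.symm

lemma br_self_eq_zero_of_odd (S : CurrentSystem lam p h₀ h₁ x) (hp : IsSeparated p)
    {i : Fin N} (hi : rootParity p i = 1) (hc : cartan p i i = 0)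
    (ε : ℤˣ) (r s : ℕ) : br (rootSign p i i) (x ε i r) (x ε i s) = 0 := by
  have h0 := S.xzero ε i i hc
  rw [rootSign_self_odd hi] at h0 ⊢
  obtain ⟨k, hk, hc⟩ := hp.nbr i
  have hεc := units_mul_ne_zero ε hc
  obtain ⟨U, hU⟩ := S.exists_double_shift k
  have hU' := hU i fun ε s => S.lie_current_of_ne hp hk ε 1 s
  refine symmetric_family_eq_zero (Z := fun r s => br (-1) (x ε i r) (x ε i s)) (fun r s => ?_) h0
    (fun r s h => ?_) (fun r s h => ?_) r s
  · simp only [br]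
    module
  · have e := lie_br_shift (R := R) (a := (ε : ℤ) * cartan p k i) (b := 0) (m := 1) (x := x ε i)
      (fun r => by rw [S.shift ε k i, zero_smul, add_zero]) (-1) r s
    rw [h, bracket_zero, smul_zero, add_zero] at e
    exact eq_zero_of_zsmul_eq_zero hεc e.symm
  · have e := lie_br_shift (hU' ε) (-1) r s
    rw [h, bracket_zero, smul_zero, add_zero] at e
    exact eq_zero_of_zsmul_eq_zero (mul_ne_zero three_ne_zero hεc) e.symm

/-- The current as a commutator with a level-zero element of the opposite sign. -/
lemma exists_current_eq_br (S : CurrentSystem lam p h₀ h₁ x) (hp : IsSeparated p)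
    (ε : ℤˣ) (i : Fin N) :
    ∃ y : A, ∀ r, current p x i r = br (rootSign p i i) (x ε i r) y := by
  rcases Int.units_eq_one_or ε with rfl | rfl
  · exact ⟨_, fun r => rfl⟩
  · refine ⟨(-rootSign p i i) • x 1 i 0, fun r => ?_⟩
    rw [← zero_add r, ← S.crossBr_eq_current hp, crossBr, zero_add, br_zsmul_right, br, br]
    rcases rootSign_eq_or p i i with h | h <;> rw [h] <;> module

/-- The shift element of another vertex commutes with the currents and raises s, so s = 0 suffices.
There the antisymmetry of the defect leaves only `h_{i,0}` and `h_{i,1}`. -/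
lemma lie_current_of_even (S : CurrentSystem lam p h₀ h₁ x) (hp : IsSeparated p)
    {i : Fin N} (hi : rootParity p i = 0) (ε : ℤˣ) (r s : ℕ) :
    ⁅current p x i (r + 1), x ε i s⁆ - ⁅current p x i r, x ε i (s + 1)⁆ =
      (((ε : ℤ) * cartan p i i) • lam) •
        (current p x i r * x ε i s + x ε i s * current p x i r) := by
  obtain ⟨y, hy⟩ := S.exists_current_eq_br hp ε i
  obtain ⟨k, hk, hc⟩ := hp.nbr i
  simp only [rootSign_self_even hi, br_one] at hy
  refine sub_eq_zero.1 (eq_zero_of_lie_eq_zsmul_succ (h₁ k - lam • h₀ k ^ 2)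
    (units_mul_ne_zero ε hc) (P := fun s => ⁅current p x i (r + 1), x ε i s⁆ -
      ⁅current p x i r, x ε i (s + 1)⁆ - (((ε : ℤ) * cartan p i i) • lam) •
        (current p x i r * x ε i s + x ε i s * current p x i r)) (fun s => ?_) ?_ s)
  · simp only [bracket_sub, bracket_smul, bracket_add, bracket_mul, bracket_bracket (h₁ k - _),
      S.lie_shift_current hp, S.shift, zero_bracket, zero_mul, mul_zero, mul_smul_comm,
      smul_mul_assoc, zero_add, add_zero]
    module
  · have hxx := S.quadraticDefect_eq_zero_of_even hp hi ε r 0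
    rw [quadraticDefect, rootSign_self_even hi, br_one, br_one, sub_eq_zero, one_smul,
      ← smul_assoc] at hxx
    rw [bracket_swap_of_quadratic hy hxx, neg_eq_zero, sub_eq_zero, zero_add, S.current_zero,
      S.current_one, S.h0x, S.lie_h1_x]

lemma lie_current_of_odd (S : CurrentSystem lam p h₀ h₁ x) (hp : IsSeparated p)
    {i : Fin N} (hi : rootParity p i = 1) (hc : cartan p i i = 0) (ε : ℤˣ)
    (r s : ℕ) : ⁅current p x i r, x ε i s⁆ = 0 := by
  obtain ⟨y, hy⟩ := S.exists_current_eq_br hp ε i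
  obtain ⟨k, hk, hc'⟩ := hp.nbr i
  refine eq_zero_of_lie_eq_zsmul_succ (h₁ k - lam • h₀ k ^ 2) (units_mul_ne_zero ε hc')
    (P := fun s => ⁅current p x i r, x ε i s⁆) (fun s => ?_) ?_ s
  · rw [bracket_bracket, S.lie_shift_current hp, S.shift, zero_bracket, zero_add, bracket_smul]
  · have hxx := S.br_self_eq_zero_of_odd hp hi hc ε r 0
    rw [rootSign_self_odd hi] at hxx
    rw [rootSign_self_odd hi] at hy
    rw [bracket_swap_of_anticommute hy hxx, S.current_zero, S.h0x, hc]
    simp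

/-- Outside the odd diagonal case, `lie_br_recursion` expresses the bracket at level r + 2 through
levels r + 1 and r, and all its terms vanish by induction. For i = j odd, the current commutes with
both factors of the other one. -/
lemma lie_current_current (S : CurrentSystem lam p h₀ h₁ x) (hp : IsSeparated p)
    (hodd : ∀ i, rootParity p i = 1 → cartan p i i = 0) (i j : Fin N)
    (r s : ℕ) : ⁅current p x i r, current p x j s⁆ = 0 := by
  by_cases hex : i = j ∧ rootParity p i = 1
  · obtain ⟨rfl, hi⟩ := hex
    rw [current.eq_def p x i s, crossBr, lie_br]
    rw [S.lie_current_of_odd hp hi (hodd i hi), S.lie_current_of_odd hp hi (hodd i hi),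
      br_zero_left, br_zero_right, zero_add]
  have hx : ∀ (ε : ℤˣ) r s, ⁅current p x i (r + 1), x ε j s⁆ - ⁅current p x i r, x ε j (s + 1)⁆ =
    (((ε : ℤ) * cartan p i j) • lam) •
      (current p x i r * x ε j s + x ε j s * current p x i r) := by
    intro ε r s
    by_cases hij : i = j
    · subst hij
      exact S.lie_current_of_even hp (by
        rcases (by decide : ∀ a : ZMod 2, a = 0 ∨ a = 1) (rootParity p i) with h | h
        · exact h
        · exact absurd ⟨rfl, h⟩ hex) ε r s
    · exact S.lie_current_of_ne hp hij ε r s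
  induction r using Nat.twoStepInduction generalizing s with
  | zero => rw [S.current_zero, S.lie_h0_crossBr]
  | one => rw [S.current_one, S.lie_h1_current hp]
  | more r ih0 ih1 =>
    have pos := fun r s => hx 1 r s
    have neg := fun r s => hx (-1) r s
    simp only [units_val_one, units_val_neg_one, one_mul, neg_one_mul, neg_smul] at pos neg
    have fold : ∀ a b, br (rootSign p j j) (x 1 j a) (x (-1) j b) = current p x j (a + b) :=
      S.crossBr_eq_current hp j
    have key := lie_br_recursion (s := rootSign p j j) (pos (r + 1) s) (pos r s)
      ((neg (r + 1) 0).trans (neg_smul _ _).symm) ((neg r 0).trans (neg_smul _ _).symm)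
    simp only [fold, bracket_add, ih0, ih1, zero_add, add_zero, sub_self, mul_zero, zero_mul,
      smul_zero] at key
    exact key

/-- The symmetric family takes values in functions of t: the second-power-sum operator also shifts
`x_j`, and its extra term at t + 2 vanishes only if vanishing is known for all t at once. -/
lemma serre_eq_zero (S : CurrentSystem lam p h₀ h₁ x) (hp : IsSeparated p)
    {i j : Fin N} (hij : i ≠ j) (hi : rootParity p i = 0)
    (hc : cartan p i i ≠ 0) {ε : ℤˣ}
    (h0 : ⁅x ε i 0, ⁅x ε i 0, x ε j 0⁆⁆ = 0) (r s t : ℕ) : serre (x ε i) (x ε j) r s t = 0 := by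
  obtain ⟨H, d, hd, Hi, Hj⟩ := S.exists_separating (hp.sep i j hij)
  obtain ⟨H', d', hd', Hj', Hi'⟩ := S.exists_separating (separation_symm (hp.sep i j hij))
  obtain ⟨U, hU⟩ := S.exists_double_shift i
  have hUi := hU i (fun ε s => S.lie_current_of_even hp hi ε 1 s) ε
  have hUj := hU j (fun ε s => S.lie_current_of_ne hp hij ε 1 s) ε
  refine congrFun (symmetric_family_eq_zero (Z := fun r s t => serre (x ε i) (x ε j) r s t)
    (fun r s => ?_) ?_ (fun r s h => ?_) (fun r s h => ?_) r s) t
  · funext t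
    exact add_comm _ _
  · funext t
    refine eq_zero_of_lie_eq_zsmul_succ H' (units_mul_ne_zero ε hd')
      (P := serre (x ε i) (x ε j) 0 0) (fun t => ?_) ?_ t
    · have e := lie_serre_shift (R := R) (H := H') (m := 1) (a := 0) (a' := ε * d') (b := 0)
        (b' := 0) (x := x ε i) (y := x ε j) (fun r => by rw [Hi']; simp) (fun r => by
        rw [Hj', zero_smul, add_zero]) 0 0 t
      rw [e]
      simp
    · rw [serre, h0, add_zero]
  · funext t
    have e := lie_serre_shift (R := R) (H := H) (m := 1) (a := ε * d) (a' := 0) (b := 0) (b' := 0)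
      (x := x ε i) (y := x ε j) (fun r => by rw [Hi, zero_smul, add_zero]) (fun r => by
        rw [Hj]; simp) r s t
    rw [congrFun h t] at e
    simp only [Pi.zero_apply, bracket_zero, smul_zero, add_zero, zero_smul] at e
    exact eq_zero_of_zsmul_eq_zero (units_mul_ne_zero ε hd) e.symm
  · funext t
    have e := lie_serre_shift hUi hUj r s t
    rw [congrFun h t, congrFun h (t + 2)] at e
    simp only [Pi.zero_apply, bracket_zero, smul_zero, add_zero] at e
    exact eq_zero_of_zsmul_eq_zero (mul_ne_zero three_ne_zero (units_mul_ne_zero ε hc)) e.symm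

/-- The middle level must stay 0, so only shifts with zero coefficient at j are allowed. Two of
them, independent on columns i and k, raise r and s separately. -/
lemma quartic_eq_zero (S : CurrentSystem lam p h₀ h₁ x)
    {i j k : Fin N} {ε : ℤˣ} {a b c : ℤ}
    (hsep : ∃ l m, cartan p l j = 0 ∧ cartan p m j = 0 ∧
      cartan p l i * cartan p m k - cartan p m i * cartan p l k ≠ 0)
      (h0 : br c (br a (x ε i 0) (x ε j 0)) (br b (x ε j 0) (x ε k 0)) = 0) (r s : ℕ) :
    br c (br a (x ε i r) (x ε j 0)) (br b (x ε j 0) (x ε k s)) = 0 := by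
  obtain ⟨l, m, hl, hm, hd⟩ := hsep
  have key : ∀ α β : ℤ, ∀ ε q r, ⁅α • (h₁ l - lam • h₀ l ^ 2) + β • (h₁ m - lam • h₀ m ^ 2),
      x ε q r⁆ = ((ε : ℤ) * (α * cartan p l q + β * cartan p m q)) • x ε q (r + 1) := by
    intro α β ε q r
    rw [add_bracket, smul_bracket, smul_bracket, S.shift, S.shift]
    module
  have k₁ := key (cartan p m k) (-cartan p l k)
  have k₂ := key (cartan p m i) (-cartan p l i)
  refine eq_zero_of_lie_eq_zsmul_succ
    (cartan p m i • (h₁ l - lam • h₀ l ^ 2) + (-cartan p l i) • (h₁ m - lam • h₀ m ^ 2))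
    (units_mul_ne_zero ε (neg_ne_zero.2 hd))
    (P := fun s => br c (br a (x ε i r) (x ε j 0)) (br b (x ε j 0) (x ε k s))) (fun s => ?_) ?_ s
  · simp only [lie_br, k₂, hl, hm, mul_zero, add_zero, zero_smul, br_zero_left, br_zero_right,
      zero_add, br_zsmul_right, br_zsmul_left]
    rw [show cartan p m i * cartan p l i + -cartan p l i * cartan p m i = 0 by ring]
    rw [mul_zero, zero_smul, zero_add]
    congr 1
    ring
  refine eq_zero_of_lie_eq_zsmul_succ
    (cartan p m k • (h₁ l - lam • h₀ l ^ 2) + (-cartan p l k) • (h₁ m - lam • h₀ m ^ 2))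
    (units_mul_ne_zero ε hd)
    (P := fun r => br c (br a (x ε i r) (x ε j 0)) (br b (x ε j 0) (x ε k 0))) (fun r => ?_) h0 r
  · simp only [lie_br, k₁, hl, hm, mul_zero, add_zero, zero_smul, br_zero_left, br_zero_right,
      zero_add, br_zsmul_right, br_zsmul_left]
    rw [show cartan p m k * cartan p l k + -cartan p l k * cartan p m k = 0 by ring]
    rw [mul_zero, zero_smul, add_zero]
    congr 1
    ring

end CurrentSystem

/-! ### The Cartan matrix and independence of its columns -/

section Cartan

variable {N : ℕ} {p : Fin (N + 1) → ZMod 2}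

lemma cartan_eq (i j : Fin N) : cartan p i j =
    (if i = j then sgn (p i.castSucc) + sgn (p i.succ) else 0) -
      (if (i : ℕ) + 1 = j then sgn (p i.succ) else 0) -
      (if (j : ℕ) + 1 = i then sgn (p j.succ) else 0) := by
  have h1 : (i.succ = j.castSucc) ↔ (i : ℕ) + 1 = j := by simp [Fin.ext_iff]
  have h2 : (j.succ = i.castSucc) ↔ (j : ℕ) + 1 = i := by simp [Fin.ext_iff]
  simp only [cartan, form, simpleRoot, Pi.sub_apply, mul_sub, Finset.sum_sub_distrib,
    Pi.single_apply, mul_ite, mul_one, mul_zero, Finset.sum_ite_eq',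
    Finset.mem_univ, if_true, Fin.castSucc_inj, Fin.succ_inj]
  simp only [← h1, ← h2, eq_comm (a := j) (b := i), eq_comm (a := j.castSucc) (b := i.succ)]
  split_ifs <;> simp_all

lemma cartan_self (i : Fin N) : cartan p i i = sgn (p i.castSucc) + sgn (p i.succ) := by
  simp [cartan_eq]

lemma cartan_succ {i j : Fin N} (h : (i : ℕ) + 1 = j) : cartan p i j = -sgn (p i.succ) := by
  rw [cartan_eq, if_neg (by rintro rfl; omega), if_pos h, if_neg (by omega)]
  simp

lemma cartan_eq_zero {i j : Fin N} (hij : i ≠ j) (h : ¬ Neighbour i j) : cartan p i j = 0 := by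
  rw [Neighbour, not_or] at h
  rw [cartan_eq, if_neg hij, if_neg h.1, if_neg h.2]
  simp

lemma Neighbour.symm {i j : Fin N} (h : Neighbour i j) : Neighbour j i := Or.symm h

lemma Neighbour.ne {i j : Fin N} (h : Neighbour i j) : i ≠ j := by
  rintro rfl
  rcases h with h | h <;> omega

lemma Neighbour.cartan_sq {i j : Fin N} (h : Neighbour i j) : cartan p i j * cartan p i j = 1 := by
  rcases h with h | h
  · rw [cartan_succ h]
    rcases sgn_eq_or (p i.succ) with h | h <;> rw [h] <;> rfl
  · rw [cartan_comm, cartan_succ h]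
    rcases sgn_eq_or (p j.succ) with h | h <;> rw [h] <;> rfl

lemma Neighbour.cartan_ne_zero {i j : Fin N} (h : Neighbour i j) : cartan p i j ≠ 0 := by
  intro h0
  have := h.cartan_sq (p := p)
  simp [h0] at this

lemma zmod_two_eq (a : ZMod 2) : a = 0 ∨ a = 1 := by
  revert a
  decide

lemma cartan_self_odd {i : Fin N} (hi : rootParity p i = 1) : cartan p i i = 0 := by
  rw [cartan_self]
  rw [rootParity] at hi
  revert hi
  generalize p i.castSucc = a
  generalize p i.succ = b
  revert a b
  decide

lemma cartan_self_even {i : Fin N} (hi : rootParity p i = 0) : cartan p i i ≠ 0 := by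
  rw [cartan_self]
  rw [rootParity] at hi
  revert hi
  generalize p i.castSucc = a
  generalize p i.succ = b
  revert a b
  decide

lemma separated_of_succ {i j : Fin N} (h : (i : ℕ) + 1 = j) :
    ∃ k l, cartan p k i * cartan p l j - cartan p l i * cartan p k j ≠ 0 := by
  refine ⟨i, j, ?_⟩
  have e : i.succ = j.castSucc := by simp [Fin.ext_iff, h]
  rw [cartan_comm j i, cartan_succ h, cartan_self, cartan_self, e]
  -- With signs a, b, c of three consecutive basis vectors the minor is (a + b)(b + c) - b² = ab +
  -- bc + ca, a sum of three odd numbers.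
  rcases sgn_eq_or (p i.castSucc) with h1 | h1 <;> rcases sgn_eq_or (p j.castSucc) with h2 | h2 <;>
    rcases sgn_eq_or (p j.succ) with h3 | h3 <;> rw [h1, h2, h3] <;> decide

lemma exists_neighbour (hN : 2 ≤ N) (i : Fin N) : ∃ k, Neighbour k i := by
  by_cases h : (i : ℕ) + 1 < N
  · exact ⟨⟨i + 1, h⟩, Or.inr rfl⟩
  · exact ⟨⟨i - 1, by omega⟩, Or.inl (show (i : ℕ) - 1 + 1 = i by omega)⟩

lemma separated_of_add_two_le (hN : 2 ≤ N)
    (hN3 : N = 3 → ∀ i j : Fin N, (i : ℕ) = 0 → (j : ℕ) = 2 → rootParity p i ≠ rootParity p j)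
    {i j : Fin N} (h : (i : ℕ) + 2 ≤ j) :
    ∃ k l, cartan p k i * cartan p l j - cartan p l i * cartan p k j ≠ 0 := by
  have far : ∀ {a b : Fin N}, (a : ℕ) + 2 ≤ b → cartan p a b = 0 := fun {a b} h =>
    cartan_eq_zero (by rintro rfl; omega) (by rw [Neighbour]; omega)
  have far' : ∀ {a b : Fin N}, (a : ℕ) + 2 ≤ b → cartan p b a = 0 := fun {a b} h => by
    rw [cartan_comm, far h]
  have nb : ∀ {k l : Fin N}, Neighbour k i → Neighbour l j →
      (cartan p l i = 0 ∨ cartan p k j = 0) →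
      ∃ k l, cartan p k i * cartan p l j - cartan p l i * cartan p k j ≠ 0 := by
    intro k l hk hl h0
    refine ⟨k, l, ?_⟩
    rw [mul_eq_zero.2 h0, sub_zero]
    exact mul_ne_zero hk.cartan_ne_zero hl.cartan_ne_zero
  obtain ⟨k, hk⟩ := exists_neighbour hN i
  obtain ⟨l, hl⟩ := exists_neighbour hN j
  rcases zmod_two_eq (rootParity p i) with hi | hi
  · rcases zmod_two_eq (rootParity p j) with hj | hj
    · refine ⟨i, j, ?_⟩
      rw [far h, mul_zero, sub_zero]
      exact mul_ne_zero (cartan_self_even hi) (cartan_self_even hj)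
    · refine ⟨i, l, ?_⟩
      rw [far h, mul_zero, sub_zero]
      exact mul_ne_zero (cartan_self_even hi) hl.cartan_ne_zero
  rcases zmod_two_eq (rootParity p j) with hj | hj
  · refine ⟨k, j, ?_⟩
    rw [far' h, zero_mul, sub_zero]
    exact mul_ne_zero hk.cartan_ne_zero (cartan_self_even hj)
  -- Both diagonal entries vanish now, so two neighbouring rows are needed, one of them meeting only
  -- one of the columns. This fails only when i and j are the odd ends of a diagram with N = 3.
  by_cases h3 : (i : ℕ) + 3 ≤ j
  · exact nb (k := ⟨i + 1, by omega⟩) (Or.inr rfl) hl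
      (Or.inr (far (show (i : ℕ) + 1 + 2 ≤ j by omega)))
  by_cases h1 : 1 ≤ (i : ℕ)
  · exact nb (k := ⟨i - 1, by omega⟩) (Or.inl (show (i : ℕ) - 1 + 1 = i by omega)) hl
      (Or.inr (far (show (i : ℕ) - 1 + 2 ≤ j by omega)))
  by_cases h4 : (j : ℕ) + 1 < N
  · exact nb hk (l := ⟨j + 1, h4⟩) (Or.inr rfl)
      (Or.inl (far' (show (i : ℕ) + 2 ≤ j + 1 by omega)))
  · exact absurd (hi.trans hj.symm) (hN3 (by omega) i j (by omega) (by omega))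

lemma isSeparated (hN : 2 ≤ N)
    (hN3 : N = 3 → ∀ i j : Fin N, (i : ℕ) = 0 → (j : ℕ) = 2 → rootParity p i ≠ rootParity p j) :
    IsSeparated p where
  sep := by
    have key : ∀ i j : Fin N, (i : ℕ) < j →
        ∃ k l, cartan p k i * cartan p l j - cartan p l i * cartan p k j ≠ 0 := by
      intro i j h
      by_cases h' : (i : ℕ) + 1 = j
      · exact separated_of_succ h'
      · exact separated_of_add_two_le hN hN3 (by omega)
    intro i j hij
    rcases lt_or_gt_of_ne (Fin.val_ne_of_ne hij) with h | h
    · exact key i j h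
    · exact CurrentSystem.separation_symm (key j i h)
  nbr := fun i => by
    obtain ⟨k, hk⟩ := exists_neighbour hN i
    exact ⟨k, hk.ne, hk.cartan_ne_zero⟩

/-- Row j has a zero at j since j is odd. A vertex just outside the triple gives a second row,
meeting only one of i and k. -/
lemma separated_triple
    (hN3 : N = 3 → ∀ i j : Fin N, (i : ℕ) = 0 → (j : ℕ) = 2 → rootParity p i ≠ rootParity p j)
    (hodd : ∀ i : Fin N, rootParity p i = 1 → ∃ j, Neighbour i j ∧ rootParity p j = 0)
    {i j k : Fin N} (hij : (i : ℕ) + 1 = j) (hjk : (j : ℕ) + 1 = k) (hj : rootParity p j = 1) :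
    ∃ l m, cartan p l j = 0 ∧ cartan p m j = 0 ∧
      cartan p l i * cartan p m k - cartan p m i * cartan p l k ≠ 0 := by
  have hji : Neighbour j i := Or.inr hij
  have hjk' : Neighbour j k := Or.inl hjk
  have zero : ∀ {a b : Fin N}, (a : ℕ) + 2 ≤ b ∨ (b : ℕ) + 2 ≤ a → cartan p a b = 0 :=
    fun {a b} h => cartan_eq_zero (by rintro rfl; omega) (by rw [Neighbour]; omega)
  by_cases h1 : (k : ℕ) + 1 < N
  · refine ⟨j, ⟨k + 1, h1⟩, cartan_self_odd hj, zero (Or.inr ?_), ?_⟩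
    · show (j : ℕ) + 2 ≤ k + 1
      omega
    · rw [zero (a := ⟨k + 1, h1⟩) (b := i) (Or.inr (show (i : ℕ) + 2 ≤ k + 1 by omega)), zero_mul,
        sub_zero]
      exact mul_ne_zero hji.cartan_ne_zero (Neighbour.cartan_ne_zero (Or.inr rfl))
  by_cases h2 : 1 ≤ (i : ℕ)
  · have hm : Neighbour (⟨i - 1, by omega⟩ : Fin N) i := Or.inl (show (i : ℕ) - 1 + 1 = i by omega)
    refine ⟨j, ⟨i - 1, by omega⟩, cartan_self_odd hj, zero (Or.inl ?_), ?_⟩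
    · show (i : ℕ) - 1 + 2 ≤ j
      omega
    · rw [zero (b := k) (Or.inl (show (i : ℕ) - 1 + 2 ≤ k by omega)), mul_zero, zero_sub,
        neg_ne_zero]
      exact mul_ne_zero hm.cartan_ne_zero hjk'.cartan_ne_zero
  -- Now N = 3 and j is the middle vertex. The ends have different parities, so one is odd, and its
  -- only neighbour is the odd vertex j.
  exfalso
  have hne := hN3 (by omega) i k (by omega) (by omega)
  have lonely : ∀ a : Fin N, (a : ℕ) ≠ j → rootParity p a = 1 → False := by
    intro a ha h
    obtain ⟨b, hb, hb0⟩ := hodd a h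
    have : b = j := by
      rw [Neighbour] at hb
      omega
    rw [this, hj] at hb0
    exact one_ne_zero hb0
  rcases zmod_two_eq (rootParity p i) with hi | hi
  · rcases zmod_two_eq (rootParity p k) with hk | hk
    · exact hne (hi.trans hk.symm)
    · exact lonely k (by omega) hk
  · exact lonely i (by omega) hi

end Cartan

/-! ### From presentations to relations in an algebra -/

section Presentation

variable {𝕜 : Type*} [Field 𝕜] {N : ℕ} {p : Fin (N + 1) → ZMod 2}

lemma sgn_zero : sgn 0 = 1 := by simp [sgn]

/-- Positive integers are invertible in `𝕜⟦ħ⟧`; this permits all later cancellation of 2, 3, minors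
and n² - 1. -/
lemma isAddTorsionFree_of_algebra [CharZero 𝕜] (A : Type*) [Ring A] [Algebra (PowerSeries 𝕜) A] :
    IsAddTorsionFree A where
  nsmul_right_injective n hn a b hab := by
    have inv : ∀ c : A, (PowerSeries.C ((n : 𝕜)⁻¹) : PowerSeries 𝕜) • (n • c) = c := by
      intro c
      rw [← Nat.cast_smul_eq_nsmul (PowerSeries 𝕜), smul_smul,
        show ((n : ℕ) : PowerSeries 𝕜) = PowerSeries.C (n : 𝕜) by simp, ← map_mul,
        inv_mul_cancel₀ (Nat.cast_ne_zero.2 hn), map_one, one_smul]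
    have hab' : n • a = n • b := hab
    rw [← inv a, hab', inv b]

section Free

variable {L : Type} {A : Type*} [Ring A] [Algebra (PowerSeries 𝕜) A]
  (F : FreeAlgebra (PowerSeries 𝕜) (Gen N L) →ₐ[PowerSeries 𝕜] A)

lemma map_comm_val (u v : Elt 𝕜 p L) :
    F (u.comm v).val = br (sgn (u.deg * v.deg)) (F u.val) (F v.val) := by
  simp only [Homog.comm, br, map_sub, map_zsmul, map_mul]

lemma map_anti_val (u v : Elt 𝕜 p L) :
    F (u.anti v).val = F u.val * F v.val + sgn (u.deg * v.deg) • (F v.val * F u.val) := by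
  simp only [Homog.anti, map_add, map_zsmul, map_mul]

lemma map_comm_fh_fh (i j : Fin N) (r s : L) :
    F ((fh 𝕜 p i r).comm (fh 𝕜 p j s)).val = ⁅F (fh 𝕜 p i r).val, F (fh 𝕜 p j s).val⁆ := by
  rw [map_comm_val, ← br_one, show (fh 𝕜 p i r).deg = 0 from rfl, zero_mul, sgn_zero]

lemma map_comm_fh_fx (ε : ℤˣ) (i j : Fin N) (r s : L) :
    F ((fh 𝕜 p i r).comm (fx 𝕜 p ε j s)).val = ⁅F (fh 𝕜 p i r).val, F (fx 𝕜 p ε j s).val⁆ := by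
  rw [map_comm_val, ← br_one, show (fh 𝕜 p i r).deg = 0 from rfl, zero_mul, sgn_zero]

lemma map_comm_fx_fx (ε ε' : ℤˣ) (i j : Fin N) (r s : L) :
    F ((fx 𝕜 p ε i r).comm (fx 𝕜 p ε' j s)).val =
      br (rootSign p i j) (F (fx 𝕜 p ε i r).val) (F (fx 𝕜 p ε' j s).val) :=
  map_comm_val F _ _

lemma map_anti_fh_fx (ε : ℤˣ) (i j : Fin N) (r s : L) :
    F ((fh 𝕜 p i r).anti (fx 𝕜 p ε j s)).val = F (fh 𝕜 p i r).val * F (fx 𝕜 p ε j s).val +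
      F (fx 𝕜 p ε j s).val * F (fh 𝕜 p i r).val := by
  rw [map_anti_val, show (fh 𝕜 p i r).deg = 0 from rfl, zero_mul, sgn_zero, one_smul]

lemma map_anti_fx_fx (ε ε' : ℤˣ) (i j : Fin N) (r s : L) :
    F ((fx 𝕜 p ε i r).anti (fx 𝕜 p ε' j s)).val = F (fx 𝕜 p ε i r).val * F (fx 𝕜 p ε' j s).val +
      rootSign p i j • (F (fx 𝕜 p ε' j s).val * F (fx 𝕜 p ε i r).val) :=
  map_anti_val F _ _

lemma map_comm_comm {ε : ℤˣ} {i j : Fin N} (hi : rootParity p i = 0) (r s t : L) :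
    F ((fx 𝕜 p ε i r).comm ((fx 𝕜 p ε i s).comm (fx 𝕜 p ε j t))).val =
      ⁅F (fx 𝕜 p ε i r).val, ⁅F (fx 𝕜 p ε i s).val, F (fx 𝕜 p ε j t).val⁆⁆ := by
  rw [map_comm_val, map_comm_val, ← br_one, ← br_one,
    show (fx 𝕜 p ε i r).deg = 0 from hi, show (fx 𝕜 p ε i s).deg = 0 from hi, zero_mul, zero_mul,
    sgn_zero]

lemma map_quartic (ε : ℤˣ) (i j k : Fin N) (r s t : L) :
    F (((fx 𝕜 p ε i r).comm (fx 𝕜 p ε j t)).comm ((fx 𝕜 p ε j t).comm (fx 𝕜 p ε k s))).val =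
      br (sgn ((rootParity p i + rootParity p j) * (rootParity p j + rootParity p k)))
        (br (rootSign p i j) (F (fx 𝕜 p ε i r).val) (F (fx 𝕜 p ε j t).val))
        (br (rootSign p j k) (F (fx 𝕜 p ε j t).val) (F (fx 𝕜 p ε k s).val)) := by
  rw [map_comm_val, map_comm_val, map_comm_val]
  rfl

end Free

section Grading

variable {R : Type*} [CommRing R] {G G' : Type*} {par : G → ZMod 2} {par' : G' → ZMod 2}
  {rel : FreeAlgebra R G → FreeAlgebra R G → Prop}
  {rel' : FreeAlgebra R G' → FreeAlgebra R G' → Prop}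

lemma map_grading_le (f : RingQuot rel →ₐ[R] RingQuot rel')
    (hf : ∀ g, f (RingQuot.mkAlgHom R rel (FreeAlgebra.ι R g)) ∈ grading R par' rel' (par g))
    (a : ZMod 2) : (grading R par rel a).map f.toLinearMap ≤ grading R par' rel' a := by
  rw [grading, Submodule.map_le_iff_le_comap, Submodule.map_le_iff_le_comap, freeGrading,
    Submodule.span_le]
  rintro _ ⟨l, rfl, rfl⟩
  change f (RingQuot.mkAlgHom R rel _) ∈ grading R par' rel' _
  induction l with
  | nil =>
    simp only [List.map_nil, List.prod_nil, List.sum_nil, map_one]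
    exact SetLike.one_mem_graded (grading R par' rel')
  | cons g l ih =>
    simp only [List.map_cons, List.prod_cons, List.sum_cons, map_mul]
    exact SetLike.mul_mem_graded (hf g) ih

end Grading

section YangianRelations

variable {A : Type*} [Ring A] [Algebra (PowerSeries 𝕜) A]
  {F : FreeAlgebra (PowerSeries 𝕜) (Gen N ℕ) →ₐ[PowerSeries 𝕜] A}

lemma lie_h0_x_of_yangianRel (hF : ∀ a b, YangianRel 𝕜 p a b → F a = F b) (ε : ℤˣ) (i j : Fin N)
    (s : ℕ) : ⁅F (fh 𝕜 p i 0).val, F (fx 𝕜 p ε j s).val⁆ =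
      ((ε : ℤ) * cartan p i j) • F (fx 𝕜 p ε j s).val := by
  have e := hF _ _ (YangianRel.h0x ε i j s)
  rwa [map_comm_fh_fx, map_zsmul] at e

lemma shift_of_yangianRel (hF : ∀ a b, YangianRel 𝕜 p a b → F a = F b) (ε : ℤˣ) (i j : Fin N)
    (hij : ¬ (i = j ∧ rootParity p i = 1)) (s : ℕ) :
    ⁅F (fh 𝕜 p i 1).val - halfHbar 𝕜 • F (fh 𝕜 p i 0).val ^ 2, F (fx 𝕜 p ε j s).val⁆ =
      ((ε : ℤ) * cartan p i j) • F (fx 𝕜 p ε j (s + 1)).val := by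
  have f := hF _ _ (YangianRel.hx ε i j 0 s hij)
  rw [map_sub, map_comm_fh_fx, map_comm_fh_fx, map_zsmul, map_smul, map_anti_fh_fx,
    lie_h0_x_of_yangianRel hF] at f
  exact bracket_sub_smul_sq (lie_h0_x_of_yangianRel hF ε i j s) f

/-- A homomorphism that respects the relations of the Drinfeld super Yangian respects those of
the finite presentation. -/
lemma minimalRel_of_yangianRel [CharZero 𝕜] (hF : ∀ a b, YangianRel 𝕜 p a b → F a = F b)
    {F' : FreeAlgebra (PowerSeries 𝕜) (Gen N (Fin 2)) →ₐ[PowerSeries 𝕜] A}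
    (hh : ∀ i (r : Fin 2), F' (fh 𝕜 p i r).val = F (fh 𝕜 p i (r : ℕ)).val)
    (hx : ∀ ε i (r : Fin 2), F' (fx 𝕜 p ε i r).val = F (fx 𝕜 p ε i (r : ℕ)).val)
    (a b : FreeAlgebra (PowerSeries 𝕜) (Gen N (Fin 2))) (hab : MinimalRel 𝕜 p a b) :
    F' a = F' b := by
  have := isAddTorsionFree_of_algebra (𝕜 := 𝕜) A
  cases hab with
  | hh i j r s =>
    have e := hF _ _ (YangianRel.hh i j r s)
    rwa [map_comm_fh_fh, map_zero, ← hh, ← hh, ← map_comm_fh_fh, ← map_zero F'] at e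
  | h0x ε i j s =>
    rw [map_comm_fh_fx, map_zsmul, hh, hx]
    exact lie_h0_x_of_yangianRel hF ε i j s
  | xx_same i r s t hrs =>
    have e := hF _ _ (YangianRel.xx_same i r s)
    rwa [hrs, map_comm_fx_fx, ← hx, ← hx, ← hh, ← map_comm_fx_fx] at e
  | xx_ne i j r s hrs hij =>
    have e := hF _ _ (YangianRel.xx_ne i j r s hij)
    rwa [map_comm_fx_fx, map_zero, ← hx, ← hx, ← map_comm_fx_fx, ← map_zero F'] at e
  | hx ε i j hij =>
    rw [map_comm_val, show (hTilde 𝕜 p i).deg = 0 from rfl, zero_mul, sgn_zero, br_one, map_zsmul,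
      hTilde, map_sub, map_smul, map_pow, hh, hh, hx, hx]
    exact shift_of_yangianRel hF ε i j hij 0
  | xx ε i j hij =>
    have e := hF _ _ (YangianRel.xx ε i j 0 0 hij)
    rw [map_sub, map_comm_fx_fx, map_comm_fx_fx, map_zsmul, map_smul, map_anti_fx_fx] at e
    rw [map_sub, map_comm_fx_fx, map_comm_fx_fx, map_zsmul, map_smul, map_anti_fx_fx, hx, hx, hx,
      hx]
    exact e
  | hx_odd ε i s hi =>
    have e := hF _ _ (YangianRel.hx_odd ε i 1 s hi)
    rw [map_comm_fh_fx, map_zero] at e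
    rw [map_comm_fh_fx, hh, hx, map_zero]
    exact e
  | xx_zero ε i j hij =>
    have e := hF _ _ (YangianRel.xx_zero ε i j 0 0 hij)
    rw [map_comm_fx_fx, map_zero] at e
    rw [map_comm_fx_fx, hx, hx, map_zero]
    exact e
  | cubic ε i j hij hi =>
    have e := hF _ _ (YangianRel.cubic ε i j 0 0 0 hij hi)
    -- At equal levels the symmetrized relation is twice the nested commutator.
    rw [map_add, map_comm_comm F hi, map_zero, ← two_zsmul] at e
    rw [map_comm_comm F' hi, hx, hx, map_zero]
    exact eq_zero_of_zsmul_eq_zero two_ne_zero e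
  | quartic ε i j k hij hjk hj =>
    have e := hF _ _ (YangianRel.quartic ε i j k 0 0 hij hjk hj)
    rw [map_quartic, map_zero] at e
    rw [map_quartic, hx, hx, hx, map_zero]
    exact e

end YangianRelations

/-! ### Construction of all levels inside the finite presentation -/

section MinimalRelations

variable {A : Type*} [Ring A] [Algebra (PowerSeries 𝕜) A]

/-- The element `h_{i,1} - (ħ/2) h_{i,0}^2`, under a homomorphism. -/
noncomputable def shiftElt (p : Fin (N + 1) → ZMod 2)
    (F : FreeAlgebra (PowerSeries 𝕜) (Gen N (Fin 2)) →ₐ[PowerSeries 𝕜] A) (i : Fin N) : A :=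
  F (fh 𝕜 p i 1).val - halfHbar 𝕜 • F (fh 𝕜 p i 0).val ^ 2

/-- The elements `x^±_{i,r}` of all levels, obtained from level `0` by commutators with
`h_{k,1} - (ħ/2) h_{k,0}^2` for the neighbour `k = nb i` of `i`. -/
noncomputable def levels (p : Fin (N + 1) → ZMod 2) (nb : Fin N → Fin N)
    (F : FreeAlgebra (PowerSeries 𝕜) (Gen N (Fin 2)) →ₐ[PowerSeries 𝕜] A) (ε : ℤˣ) (i : Fin N) :
    ℕ → A
  | 0 => F (fx 𝕜 p ε i 0).val
  | r + 1 => ((ε : ℤ) * cartan p (nb i) i) • ⁅shiftElt p F (nb i), levels p nb F ε i r⁆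

variable {nb : Fin N → Fin N}
  {F : FreeAlgebra (PowerSeries 𝕜) (Gen N (Fin 2)) →ₐ[PowerSeries 𝕜] A}

lemma lie_h_h_of_minimalRel (hF : ∀ a b, MinimalRel 𝕜 p a b → F a = F b) (i j : Fin N)
    (r s : Fin 2) : ⁅F (fh 𝕜 p i r).val, F (fh 𝕜 p j s).val⁆ = 0 := by
  have e := hF _ _ (MinimalRel.hh i j r s)
  rwa [map_comm_fh_fh, map_zero] at e

lemma lie_h_shiftElt (hF : ∀ a b, MinimalRel 𝕜 p a b → F a = F b) (i j : Fin N) (r : Fin 2) :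
    ⁅F (fh 𝕜 p i r).val, shiftElt p F j⁆ = 0 := by
  rw [shiftElt, bracket_sub, bracket_smul, pow_two, bracket_mul, lie_h_h_of_minimalRel hF,
    lie_h_h_of_minimalRel hF]
  simp

lemma lie_shiftElt_shiftElt (hF : ∀ a b, MinimalRel 𝕜 p a b → F a = F b) (i j : Fin N) :
    ⁅shiftElt p F i, shiftElt p F j⁆ = 0 := by
  rw [shiftElt, sub_bracket, lie_h_shiftElt hF, smul_bracket, bracket_antisymm (_ ^ 2), pow_two,
    bracket_mul, bracket_antisymm (shiftElt p F j), lie_h_shiftElt hF]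
  simp

/-- The excluded case of an odd vertex with itself fits the same formula: c_{ii} = 0, and both
`h_{i,0}` and `h_{i,1}` commute with `x^±_{i,0}`. -/
lemma lie_shiftElt_x_zero (hF : ∀ a b, MinimalRel 𝕜 p a b → F a = F b) (ε : ℤˣ) (i j : Fin N) :
    ⁅shiftElt p F i, F (fx 𝕜 p ε j 0).val⁆ =
      ((ε : ℤ) * cartan p i j) • F (fx 𝕜 p ε j 1).val := by
  by_cases hij : i = j ∧ rootParity p i = 1
  · obtain ⟨rfl, hi⟩ := hij
    have e := hF _ _ (MinimalRel.hx_odd ε i 0 hi)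
    have f := hF _ _ (MinimalRel.h0x ε i i 0)
    rw [map_comm_fh_fx, map_zero] at e
    rw [map_comm_fh_fx, cartan_self_odd hi, mul_zero, zero_smul, map_zero] at f
    rw [shiftElt, sub_bracket, e, smul_bracket, bracket_antisymm (_ ^ 2), pow_two, bracket_mul,
      bracket_antisymm (F (fx 𝕜 p ε i 0).val), f, cartan_self_odd hi]
    simp
  · have e := hF _ _ (MinimalRel.hx ε i j hij)
    rwa [map_comm_val, show (hTilde 𝕜 p i).deg = 0 from rfl, zero_mul, sgn_zero, br_one,
      map_zsmul, hTilde, map_sub, map_smul, map_pow] at e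

lemma unit_mul_cartan_sq (ε : ℤˣ) {i j : Fin N} (h : Neighbour i j) :
    ((ε : ℤ) * cartan p i j) * ((ε : ℤ) * cartan p i j) = 1 := by
  rw [mul_mul_mul_comm, h.cartan_sq, ← Units.val_mul, Int.units_mul_self, Units.val_one, one_mul]

lemma levels_one (hF : ∀ a b, MinimalRel 𝕜 p a b → F a = F b) (hnb : ∀ i, Neighbour (nb i) i)
    (ε : ℤˣ) (i : Fin N) : levels p nb F ε i 1 = F (fx 𝕜 p ε i 1).val := by
  rw [levels, levels, lie_shiftElt_x_zero hF, smul_smul, unit_mul_cartan_sq ε (hnb i), one_smul]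

/-- Shift elements commute, so the bracket with vertex i passes through the one with `nb j` that
defines the next level. Hence the choice of neighbour is immaterial. -/
lemma lie_shiftElt_levels (hF : ∀ a b, MinimalRel 𝕜 p a b → F a = F b)
    (hnb : ∀ i, Neighbour (nb i) i) (ε : ℤˣ) (i j : Fin N) (r : ℕ) :
    ⁅shiftElt p F i, levels p nb F ε j r⁆ =
      ((ε : ℤ) * cartan p i j) • levels p nb F ε j (r + 1) := by
  induction r with
  | zero => rw [levels_one hF hnb, levels, lie_shiftElt_x_zero hF]
  | succ r ih =>
    rw [levels, bracket_smul, bracket_bracket, lie_shiftElt_shiftElt hF, zero_bracket, zero_add,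
      ih, bracket_smul, levels.eq_2 (r := r + 1), smul_comm]

lemma lie_h0_levels (hF : ∀ a b, MinimalRel 𝕜 p a b → F a = F b) (ε : ℤˣ) (i j : Fin N) (r : ℕ) :
    ⁅F (fh 𝕜 p i 0).val, levels p nb F ε j r⁆ =
      ((ε : ℤ) * cartan p i j) • levels p nb F ε j r := by
  induction r with
  | zero =>
    have e := hF _ _ (MinimalRel.h0x ε i j 0)
    rwa [map_comm_fh_fx, map_zsmul] at e
  | succ r ih =>
    rw [levels, bracket_smul, bracket_bracket, lie_h_shiftElt hF, zero_bracket, zero_add,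
      ih, bracket_smul, smul_comm]

lemma currentSystem_levels (hF : ∀ a b, MinimalRel 𝕜 p a b → F a = F b)
    (hnb : ∀ i, Neighbour (nb i) i) :
    CurrentSystem (halfHbar 𝕜) p (fun i => F (fh 𝕜 p i 0).val) (fun i => F (fh 𝕜 p i 1).val)
      (levels p nb F) where
  h11 i j := lie_h_h_of_minimalRel hF i j 1 1
  h0x := lie_h0_levels hF
  shift := lie_shiftElt_levels hF hnb
  x00 i := by
    have e := hF _ _ (MinimalRel.xx_same i 0 0 0 rfl)
    rwa [map_comm_fx_fx] at e
  x10 i := by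
    have e := hF _ _ (MinimalRel.xx_same i 1 0 1 rfl)
    rwa [map_comm_fx_fx, ← levels_one hF hnb] at e
  x01 i := by
    have e := hF _ _ (MinimalRel.xx_same i 0 1 1 rfl)
    rwa [map_comm_fx_fx, ← levels_one hF hnb] at e
  xne i j hij := by
    have e := hF _ _ (MinimalRel.xx_ne i j 0 0 (by simp) hij)
    rwa [map_comm_fx_fx, map_zero] at e
  xx ε i j hij := by
    have e := hF _ _ (MinimalRel.xx ε i j hij)
    rwa [map_sub, map_comm_fx_fx, map_comm_fx_fx, map_zsmul, map_smul, map_anti_fx_fx,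
      ← levels_one hF hnb, ← levels_one hF hnb] at e
  xzero ε i j hij := by
    have e := hF _ _ (MinimalRel.xx_zero ε i j hij)
    rwa [map_comm_fx_fx, map_zero] at e

/-- A homomorphism that respects the relations of the finite presentation extends to one that
respects the relations of the Drinfeld super Yangian. -/
lemma yangianRel_of_minimalRel [CharZero 𝕜] (hF : ∀ a b, MinimalRel 𝕜 p a b → F a = F b)
    (hnb : ∀ i, Neighbour (nb i) i) (hp : IsSeparated p)
    (htriple : ∀ i j k : Fin N, (i : ℕ) + 1 = j → (j : ℕ) + 1 = k → rootParity p j = 1 →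
      ∃ l m, cartan p l j = 0 ∧ cartan p m j = 0 ∧
        cartan p l i * cartan p m k - cartan p m i * cartan p l k ≠ 0)
    {F' : FreeAlgebra (PowerSeries 𝕜) (Gen N ℕ) →ₐ[PowerSeries 𝕜] A}
    (hh : ∀ i r, F' (fh 𝕜 p i r).val = CurrentSystem.current p (levels p nb F) i r)
    (hx : ∀ ε i r, F' (fx 𝕜 p ε i r).val = levels p nb F ε i r)
    (a b : FreeAlgebra (PowerSeries 𝕜) (Gen N ℕ)) (hab : YangianRel 𝕜 p a b) :
    F' a = F' b := by
  have := isAddTorsionFree_of_algebra (𝕜 := 𝕜) A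
  have S := currentSystem_levels hF hnb
  have even : ∀ i, ¬ rootParity p i = 1 → rootParity p i = 0 := fun i hi =>
    (zmod_two_eq _).resolve_right hi
  cases hab with
  | hh i j r s =>
    rw [map_comm_fh_fh, hh, hh, map_zero]
    exact S.lie_current_current hp (fun i => cartan_self_odd) i j r s
  | h0x ε i j s =>
    rw [map_comm_fh_fx, map_zsmul, hh, hx, S.current_zero]
    exact S.h0x ε i j s
  | xx_same i r s =>
    rw [map_comm_fx_fx, hh, hx, hx]
    exact S.crossBr_eq_current hp i r s
  | xx_ne i j r s hij =>
    rw [map_comm_fx_fx, hx, hx, map_zero]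
    exact S.br_pos_neg_eq_zero hij (hp.sep i j hij) r s
  | hx ε i j r s hij =>
    rw [map_sub, map_comm_fh_fx, map_comm_fh_fx, map_zsmul, map_smul, map_anti_fh_fx, hh, hh, hx,
      hx, ← smul_assoc]
    by_cases h : i = j
    · subst h
      exact S.lie_current_of_even hp (even i fun h => hij ⟨rfl, h⟩) ε r s
    · exact S.lie_current_of_ne hp h ε r s
  | xx ε i j r s hij =>
    rw [map_sub, map_comm_fx_fx, map_comm_fx_fx, map_zsmul, map_smul, map_anti_fx_fx, hx, hx, hx,
      hx, ← sub_eq_zero]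
    by_cases h : i = j
    · subst h
      exact S.quadraticDefect_eq_zero_of_even hp (even i fun h => hij ⟨rfl, h⟩) ε r s
    · exact S.quadraticDefect_eq_zero_of_ne h (hp.sep i j h) ε r s
  | hx_odd ε i r s hi =>
    rw [map_comm_fh_fx, hh, hx, map_zero]
    exact S.lie_current_of_odd hp hi (cartan_self_odd hi) ε r s
  | xx_zero ε i j r s hij =>
    rw [map_comm_fx_fx, hx, hx, map_zero]
    by_cases h : i = j
    · subst h
      refine S.br_self_eq_zero_of_odd hp ?_ hij ε r s
      exact (zmod_two_eq _).resolve_left fun h => cartan_self_even h hij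
    · exact S.br_eq_zero_of_ne hij (hp.sep i j h) ε r s
  | cubic ε i j r s t hij hi =>
    have e := hF _ _ (MinimalRel.cubic ε i j hij hi)
    rw [map_comm_comm F hi, map_zero] at e
    rw [map_add, map_comm_comm F' hi, map_comm_comm F' hi, hx, hx, hx, map_zero]
    exact S.serre_eq_zero hp hij.ne hi (cartan_self_even hi) e r s t
  | quartic ε i j k r s hij hjk hj =>
    have e := hF _ _ (MinimalRel.quartic ε i j k hij hjk hj)
    rw [map_quartic, map_zero] at e
    rw [map_quartic, hx, hx, hx, map_zero]
    exact S.quartic_eq_zero (htriple i j k hij hjk hj) e r s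

end MinimalRelations

end Presentation

/-! ### The mutually inverse homomorphisms and parity -/

section Isomorphism

variable {𝕜 : Type*} [Field 𝕜] {N : ℕ} {p : Fin (N + 1) → ZMod 2} {nb : Fin N → Fin N}

lemma map_br {A B 𝓕 : Type*} [Ring A] [Ring B] [FunLike 𝓕 A B] [RingHomClass 𝓕 A B] (f : 𝓕)
    (s : ℤ) (a b : A) : f (br s a b) = br s (f a) (f b) := by
  simp only [br, map_sub, map_mul, map_zsmul]

section Map

variable {A B : Type*} [Ring A] [Algebra (PowerSeries 𝕜) A] [Ring B] [Algebra (PowerSeries 𝕜) B]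

lemma map_levels (f : A →ₐ[PowerSeries 𝕜] B)
    (F : FreeAlgebra (PowerSeries 𝕜) (Gen N (Fin 2)) →ₐ[PowerSeries 𝕜] A) (ε : ℤˣ) (i : Fin N)
    (r : ℕ) : f (levels p nb F ε i r) = levels p nb (f.comp F) ε i r := by
  induction r with
  | zero => rfl
  | succ r ih =>
    rw [levels, levels, map_zsmul, ← br_one, ← br_one, map_br, ih, shiftElt, shiftElt, map_sub,
      map_smul, map_pow]
    rfl

lemma map_current (f : A →ₐ[PowerSeries 𝕜] B) (x : ℤˣ → Fin N → ℕ → A) (i : Fin N) (r : ℕ) :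
    f (CurrentSystem.current p x i r) = CurrentSystem.current p (fun ε i r => f (x ε i r)) i r :=
  map_br f _ _ _

variable {F : FreeAlgebra (PowerSeries 𝕜) (Gen N ℕ) →ₐ[PowerSeries 𝕜] A}
  {F' : FreeAlgebra (PowerSeries 𝕜) (Gen N (Fin 2)) →ₐ[PowerSeries 𝕜] A}

/-- The Yangian generators obey the recursion defining `levels`: as `nb i` differs from i, the shift
relation applies, and its coefficient ±1 is its own inverse. -/
lemma levels_eq_of_yangianRel (hF : ∀ a b, YangianRel 𝕜 p a b → F a = F b)
    (hnb : ∀ i, Neighbour (nb i) i)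
    (hh : ∀ i (r : Fin 2), F' (fh 𝕜 p i r).val = F (fh 𝕜 p i (r : ℕ)).val)
    (hx : ∀ ε i (r : Fin 2), F' (fx 𝕜 p ε i r).val = F (fx 𝕜 p ε i (r : ℕ)).val)
    (ε : ℤˣ) (i : Fin N) (r : ℕ) : levels p nb F' ε i r = F (fx 𝕜 p ε i r).val := by
  induction r with
  | zero => exact hx ε i 0
  | succ r ih =>
    have e := shift_of_yangianRel hF ε (nb i) i (fun h => (hnb i).ne h.1) r
    rw [levels, ih, shiftElt, hh, hh]
    change ((ε : ℤ) * cartan p (nb i) i) • ⁅F (fh 𝕜 p (nb i) 1).val -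
      halfHbar 𝕜 • F (fh 𝕜 p (nb i) 0).val ^ 2, F (fx 𝕜 p ε i r).val⁆ = _
    rw [e, smul_smul, unit_mul_cartan_sq ε (hnb i), one_smul]

lemma current_eq_of_yangianRel (hF : ∀ a b, YangianRel 𝕜 p a b → F a = F b)
    {x : ℤˣ → Fin N → ℕ → A} (hx : ∀ ε i r, x ε i r = F (fx 𝕜 p ε i r).val) (i : Fin N) (r : ℕ) :
    CurrentSystem.current p x i r = F (fh 𝕜 p i r).val := by
  have e := hF _ _ (YangianRel.xx_same i r 0)
  rwa [map_comm_fx_fx, ← hx, ← hx] at e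

section Parity

variable {𝒜 : ZMod 2 → Submodule (PowerSeries 𝕜) A} [SetLike.GradedMonoid 𝒜]

lemma br_mem {a b : ZMod 2} {u v : A} (s : ℤ) (hu : u ∈ 𝒜 a) (hv : v ∈ 𝒜 b) :
    br s u v ∈ 𝒜 (a + b) :=
  sub_mem (SetLike.mul_mem_graded hu hv)
    (zsmul_mem (add_comm b a ▸ SetLike.mul_mem_graded hv hu) s)

lemma levels_mem (hF : ∀ g : Gen N (Fin 2), F' (gen 𝕜 p g).val ∈ 𝒜 (g.parity p)) (ε : ℤˣ)
    (i : Fin N) (r : ℕ) : levels p nb F' ε i r ∈ 𝒜 (rootParity p i) := by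
  induction r with
  | zero => exact hF (.x ε i 0)
  | succ r ih =>
    have hs : shiftElt p F' (nb i) ∈ 𝒜 0 := by
      refine sub_mem (hF (.h (nb i) 1)) (Submodule.smul_mem _ _ ?_)
      have h := SetLike.pow_mem_graded 2 (hF (.h (nb i) 0))
      rwa [show (Gen.h (nb i) (0 : Fin 2)).parity p = 0 from rfl, smul_zero] at h
    have h := br_mem 1 hs ih
    rw [zero_add, br_one] at h
    exact zsmul_mem h _

lemma current_mem {x : ℤˣ → Fin N → ℕ → A} (hx : ∀ ε i r, x ε i r ∈ 𝒜 (rootParity p i))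
    (i : Fin N) (r : ℕ) : CurrentSystem.current p x i r ∈ 𝒜 0 := by
  have h := br_mem (rootSign p i i) (hx 1 i r) (hx (-1) i 0)
  rwa [CharTwo.add_self_eq_zero] at h

end Parity

end Map

variable (𝕜 p) in
/-- The images of the generators of the finite presentation in the Drinfeld super Yangian. -/
noncomputable def genToYangian : Gen N (Fin 2) → Yangian 𝕜 p
  | .h i r => Yangian.h 𝕜 p i r
  | .x ε i r => Yangian.x 𝕜 p ε i r

variable (𝕜 p) in
/-- The images of the generators of the Drinfeld super Yangian in the finite presentation. -/
noncomputable def genToMinimal (nb : Fin N → Fin N) : Gen N ℕ → MinimalYangian 𝕜 p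
  | .h i r => CurrentSystem.current p
      (levels p nb (RingQuot.mkAlgHom (PowerSeries 𝕜) (MinimalRel 𝕜 p))) i r
  | .x ε i r => levels p nb (RingQuot.mkAlgHom (PowerSeries 𝕜) (MinimalRel 𝕜 p)) ε i r

lemma mkAlgHom_yangianRel (a b : FreeAlgebra (PowerSeries 𝕜) (Gen N ℕ))
    (hab : YangianRel 𝕜 p a b) :
    RingQuot.mkAlgHom (PowerSeries 𝕜) (YangianRel 𝕜 p) a =
      RingQuot.mkAlgHom (PowerSeries 𝕜) (YangianRel 𝕜 p) b :=
  RingQuot.mkAlgHom_rel (PowerSeries 𝕜) hab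

lemma mkAlgHom_minimalRel (a b : FreeAlgebra (PowerSeries 𝕜) (Gen N (Fin 2)))
    (hab : MinimalRel 𝕜 p a b) :
    RingQuot.mkAlgHom (PowerSeries 𝕜) (MinimalRel 𝕜 p) a =
      RingQuot.mkAlgHom (PowerSeries 𝕜) (MinimalRel 𝕜 p) b :=
  RingQuot.mkAlgHom_rel (PowerSeries 𝕜) hab

/-- Mutually inverse homomorphisms between the two presentations, given on generators. -/
lemma exists_inverse_homs [CharZero 𝕜] (hnb : ∀ i, Neighbour (nb i) i) (hp : IsSeparated p)
    (htriple : ∀ i j k : Fin N, (i : ℕ) + 1 = j → (j : ℕ) + 1 = k → rootParity p j = 1 →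
      ∃ l m, cartan p l j = 0 ∧ cartan p m j = 0 ∧
        cartan p l i * cartan p m k - cartan p m i * cartan p l k ≠ 0) :
    ∃ (φ : MinimalYangian 𝕜 p →ₐ[PowerSeries 𝕜] Yangian 𝕜 p)
      (ψ : Yangian 𝕜 p →ₐ[PowerSeries 𝕜] MinimalYangian 𝕜 p),
      (∀ g, φ (RingQuot.mkAlgHom (PowerSeries 𝕜) (MinimalRel 𝕜 p) (FreeAlgebra.ι _ g)) =
        genToYangian 𝕜 p g) ∧
      (∀ g, ψ (RingQuot.mkAlgHom (PowerSeries 𝕜) (YangianRel 𝕜 p) (FreeAlgebra.ι _ g)) =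
        genToMinimal 𝕜 p nb g) ∧
      φ.comp ψ = AlgHom.id _ _ ∧ ψ.comp φ = AlgHom.id _ _ := by
  have hφ := minimalRel_of_yangianRel (mkAlgHom_yangianRel (𝕜 := 𝕜) (p := p))
    (F' := FreeAlgebra.lift (PowerSeries 𝕜) (genToYangian 𝕜 p))
    (fun i r => FreeAlgebra.lift_ι_apply _ _) (fun ε i r => FreeAlgebra.lift_ι_apply _ _)
  have hψ := yangianRel_of_minimalRel (mkAlgHom_minimalRel (𝕜 := 𝕜) (p := p)) hnb hp htriple
    (F' := FreeAlgebra.lift (PowerSeries 𝕜) (genToMinimal 𝕜 p nb))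
    (fun i r => FreeAlgebra.lift_ι_apply _ _) (fun ε i r => FreeAlgebra.lift_ι_apply _ _)
  let φ : MinimalYangian 𝕜 p →ₐ[PowerSeries 𝕜] Yangian 𝕜 p :=
    RingQuot.liftAlgHom (PowerSeries 𝕜)
      ⟨FreeAlgebra.lift (PowerSeries 𝕜) (genToYangian 𝕜 p), fun {a b} => hφ a b⟩
  let ψ : Yangian 𝕜 p →ₐ[PowerSeries 𝕜] MinimalYangian 𝕜 p :=
    RingQuot.liftAlgHom (PowerSeries 𝕜)
      ⟨FreeAlgebra.lift (PowerSeries 𝕜) (genToMinimal 𝕜 p nb), fun {a b} => hψ a b⟩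
  have φg : ∀ g, φ (RingQuot.mkAlgHom (PowerSeries 𝕜) (MinimalRel 𝕜 p) (FreeAlgebra.ι _ g)) =
      genToYangian 𝕜 p g := fun g =>
    (RingQuot.liftAlgHom_mkAlgHom_apply ..).trans (FreeAlgebra.lift_ι_apply _ _)
  have ψg : ∀ g, ψ (RingQuot.mkAlgHom (PowerSeries 𝕜) (YangianRel 𝕜 p) (FreeAlgebra.ι _ g)) =
      genToMinimal 𝕜 p nb g := fun g =>
    (RingQuot.liftAlgHom_mkAlgHom_apply ..).trans (FreeAlgebra.lift_ι_apply _ _)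
  have φx : ∀ ε i r, φ (levels p nb (RingQuot.mkAlgHom (PowerSeries 𝕜) (MinimalRel 𝕜 p)) ε i r) =
      Yangian.x 𝕜 p ε i r := by
    intro ε i r
    have e := map_levels (𝕜 := 𝕜) (A := MinimalYangian 𝕜 p) (B := Yangian 𝕜 p) (p := p)
      (nb := nb) φ
      (RingQuot.mkAlgHom (PowerSeries 𝕜) (MinimalRel 𝕜 p)) ε i r
    exact e.trans (levels_eq_of_yangianRel (mkAlgHom_yangianRel (𝕜 := 𝕜) (p := p)) hnb
      (fun i r => φg (.h i r)) (fun ε i r => φg (.x ε i r)) ε i r)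
  refine ⟨φ, ψ, φg, ψg, ?_, ?_⟩
  · refine RingQuot.ringQuot_ext' _ _ _ (FreeAlgebra.hom_ext (funext fun g => ?_))
    change φ (ψ (RingQuot.mkAlgHom (PowerSeries 𝕜) (YangianRel 𝕜 p) (FreeAlgebra.ι _ g))) =
      RingQuot.mkAlgHom (PowerSeries 𝕜) (YangianRel 𝕜 p) (FreeAlgebra.ι _ g)
    rw [ψg]
    cases g with
    | h i r =>
      refine (map_current (𝕜 := 𝕜) (A := MinimalYangian 𝕜 p) (B := Yangian 𝕜 p) φ _ i r).trans ?_
      exact current_eq_of_yangianRel (𝕜 := 𝕜) (A := Yangian 𝕜 p) mkAlgHom_yangianRel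
        (x := fun ε i r => φ (levels p nb (RingQuot.mkAlgHom _ (MinimalRel 𝕜 p)) ε i r)) φx i r
    | x ε i r => exact φx ε i r
  · refine RingQuot.ringQuot_ext' _ _ _ (FreeAlgebra.hom_ext (funext fun g => ?_))
    change ψ (φ (RingQuot.mkAlgHom (PowerSeries 𝕜) (MinimalRel 𝕜 p) (FreeAlgebra.ι _ g))) =
      RingQuot.mkAlgHom (PowerSeries 𝕜) (MinimalRel 𝕜 p) (FreeAlgebra.ι _ g)
    rw [φg]
    have S := currentSystem_levels (𝕜 := 𝕜) (A := MinimalYangian 𝕜 p)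
      (mkAlgHom_minimalRel (p := p)) hnb
    cases g with
    | h i r =>
      refine (ψg (.h i r)).trans ?_
      match r with
      | 0 => exact S.current_zero i
      | 1 => exact S.current_one i
    | x ε i r =>
      refine (ψg (.x ε i r)).trans ?_
      match r with
      | 0 => rfl
      | 1 => exact levels_one (𝕜 := 𝕜) (A := MinimalYangian 𝕜 p) mkAlgHom_minimalRel hnb ε i

end Isomorphism

end SuperYangian

theorem mainTheorem4 (𝕜 : Type*) [Field 𝕜] [IsAlgClosed 𝕜] [CharZero 𝕜]
    (N : ℕ) (hN : 1 ≤ N) (hN1 : N ≠ 1) (p : Fin (N + 1) → ZMod 2)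
    (hN3 : N = 3 → ∀ i j : Fin N, (i : ℕ) = 0 → (j : ℕ) = 2 →
      SuperYangian.rootParity p i ≠ SuperYangian.rootParity p j)
    (hodd : ∀ i : Fin N, SuperYangian.rootParity p i = 1 →
      ∃ j : Fin N, SuperYangian.Neighbour i j ∧ SuperYangian.rootParity p j = 0) :
    ∃ e : SuperYangian.MinimalYangian 𝕜 p ≃ₐ[PowerSeries 𝕜] SuperYangian.Yangian 𝕜 p,
      (∀ a : ZMod 2, (SuperYangian.MinimalYangian.parityPart 𝕜 p a).map e.toLinearMap =
        SuperYangian.Yangian.parityPart 𝕜 p a) ∧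
      (∀ (i : Fin N) (r : Fin 2),
        e (SuperYangian.MinimalYangian.h 𝕜 p i r) = SuperYangian.Yangian.h 𝕜 p i r) ∧
      (∀ (ε : ℤˣ) (i : Fin N) (r : Fin 2),
        e (SuperYangian.MinimalYangian.x 𝕜 p ε i r) = SuperYangian.Yangian.x 𝕜 p ε i r) := by
  have hN2 : 2 ≤ N := by omega
  choose nb hnb using SuperYangian.exists_neighbour hN2
  obtain ⟨φ, ψ, φg, ψg, h₁, h₂⟩ := SuperYangian.exists_inverse_homs (𝕜 := 𝕜) hnb
    (SuperYangian.isSeparated hN2 hN3)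
    (fun i j k hij hjk hj => SuperYangian.separated_triple hN3 hodd hij hjk hj)
  refine ⟨AlgEquiv.ofAlgHom φ ψ h₁ h₂, fun a => le_antisymm ?_ ?_, fun i r => φg (.h i r),
    fun ε i r => φg (.x ε i r)⟩
  · refine SuperYangian.map_grading_le φ (fun g => ?_) a
    rw [φg]
    cases g with
    | h i r => exact ⟨_, (SuperYangian.fh 𝕜 p i (r : ℕ)).mem, rfl⟩
    | x ε i r => exact ⟨_, (SuperYangian.fx 𝕜 p ε i (r : ℕ)).mem, rfl⟩
  -- The reverse inclusion holds because the inverse also preserves parity: `levels` and currents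
  -- are homogeneous of the right degree.
  · intro y hy
    refine ⟨ψ y, SuperYangian.map_grading_le ψ (fun g => ?_) a ⟨y, hy, rfl⟩,
      DFunLike.congr_fun h₁ y⟩
    rw [ψg]
    have hx := SuperYangian.levels_mem (𝕜 := 𝕜) (p := p) (nb := nb)
      (A := SuperYangian.MinimalYangian 𝕜 p)
      (𝒜 := SuperYangian.MinimalYangian.parityPart 𝕜 p)
      (F' := RingQuot.mkAlgHom (PowerSeries 𝕜) (SuperYangian.MinimalRel 𝕜 p))
      (fun g => Submodule.mem_map_of_mem (SuperYangian.gen 𝕜 p g).mem)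
    cases g with
    | h i r => exact SuperYangian.current_mem hx i r
    | x ε i r => exact hx ε i r
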